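/- Let $n,n_u,n_v\in\mathbb N$, $\alpha\in(0,1)$, $T>0$, let $P\subset\mathbb R^{n_u}$ and $Q\subset\mathbb R^{n_v}$ be compact, and let $g:[0,T]\times\mathbb R^n\times P\times Q\to\mathbb R^n$ satisfy: (g.1) $g$ is continuous; (g.2) for every $r\ge 0$ there is $\lambda_g>0$ with $\|g(t,x,u,v)-g(t,y,u,v)\|\le\lambda_g\|x-y\|$ for all $t\in[0,T]$, $\|x\|,\|y\|\le r$, $u\in P$, $v\in Q$; (g.3) there is $c_g>0$ with $\|g(t,x,u,v)\|\le(1+\|x\|)c_g$ for all $t\in[0,T]$, $x\in\mathbb R^n$, $u\in P$, $v\in Q$; (g.4) $\min_{u\in P}\max_{v\in Q}\langle s,g(t,x,u,v)\rangle=\max_{v\in Q}\min_{u\in P}\langle s,g(t,x,u,v)\rangle$ for all $t\in[0,T]$, $x,s\in\mathbb R^n$. Here $\langle\cdot,\cdot\rangle$ and $\|\cdot\|$ are the Euclidean scalar product and norm. Let $\mathcal U$ and $\mathcal V$ be the sets of all Lebesgue measurable functions $[0,T)\to P$ and $[0,T)\to Q$, respectively. For $x_0\in\mathbb R^n$, $u\in\mathcal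 U$, $v\in\mathcal V$, a motion $x(\cdot;x_0,u,v)$ is a function $x:[0,T]\to\mathbb R^n$ of the form $$x(t)=x_0+\frac1{\Gamma(\alpha)}\int_0^t\frac{\varphi(\tau)}{(t-\tau)^{1-\alpha}}\,d\tau,\qquad t\in[0,T],$$ with some $\varphi\in L^\infty([0,T],\mathbb R^n)$, such that $({}^CD^\alpha x)(t)=g(t,x(t),u(t),v(t))$ for almost every $t\in[0,T]$, where $$({}^CD^\alpha x)(t)=\frac1{\Gamma(1-\alpha)}\frac{d}{dt}\int_0^t\frac{x(\tau)-x(0)}{(t-\tau)^{\alpha}}\,d\tau$$ is the Caputo derivative. A motion of the system is $x=x(\cdot;x_0,u,v)$, and a motion of the guide is $y=x(\cdot;y_0,\widetilde u,\widetilde v)$, with $y_0\in\mathbb R^n$, $\widetilde u\in\mathcal U$, $\widetilde v\in\mathcal V$. Given a partition $\Delta$: $0=\tau_1<\tau_2<\dots<\tau_{k+1}=T$, $k\ge1$, with diameter $\operatorname{diam}(\Delta)=\max_{1\le j\le k}(\tau_{j+1}-\tau_j)$, the realizations $u$ and $\widetilde v$ are said to be formed by the mutual aiming procedure if for every $j=1,\dots,k$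 there are, with $s(\tau_j)=x(\tau_j)-y(\tau_j)$, $$u_j\in\operatorname*{argmin}_{u\in P}\max_{v\in Q}\langle s(\tau_j),g(\tau_j,x(\tau_j),u,v)\rangle,\qquad \widetilde v_j\in\operatorname*{argmax}_{\widetilde v\in Q}\min_{\widetilde u\in P}\langle s(\tau_j),g(\tau_j,x(\tau_j),\widetilde u,\widetilde v)\rangle$$ such that $u(t)=u_j$ and $\widetilde v(t)=\widetilde v_j$ for all $t\in[\tau_j,\tau_{j+1})$. **Theorem.** For any $R_0>0$ and $\varepsilon>0$ there exist $K>0$ and $\delta>0$ such that, for any $x_0,y_0\in\mathbb R^n$ with $\|x_0\|,\|y_0\|\le R_0$, any partition $\Delta$ of $[0,T]$ with $\operatorname{diam}(\Delta)\le\delta$, and any $v\in\mathcal V$, $\widetilde u\in\mathcal U$: if $u\in\mathcal U$ and $\widetilde v\in\mathcal V$ are formed by the mutual aiming procedure, then the corresponding motions $x=x(\cdot;x_0,u,v)$ of the system and $y=x(\cdot;y_0,\widetilde u,\widetilde v)$ of the guide satisfy $$\|x(\cdot)-y(\cdot)\|_\infty=\operatorname*{ess\,sup}_{t\in[0,T]}\|x(t)-y(t)\|\le\varepsilon+K\|x_0-y_0\|.$$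 -/

import Mathlib

open MeasureTheory Set
open scoped ENNReal

noncomputable section

namespace FractionalControl

/-- The `k`-dimensional Euclidean space. -/
abbrev E (k : ℕ) := EuclideanSpace ℝ (Fin k)

/-- Lebesgue measure on the segment `[0, T]`. -/
abbrev segMeasure (T : ℝ) : Measure ℝ := volume.restrict (Icc 0 T)

/-- The left-sided Riemann-Liouville fractional integral of order `α`:
`(I^α φ)(t) = 1 / Γ(α) ∫₀ᵗ φ(τ) / (t - τ)^(1 - α) dτ`. -/
def rlIntegral {k : ℕ} (α : ℝ) (φ : ℝ → E k) (t : ℝ) : E k :=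
  (1 / Real.Gamma α) • ∫ τ in (0 : ℝ)..t, (1 / (t - τ) ^ (1 - α)) • φ τ

/-- `x` belongs to `{x₀} + I^α (L^∞([0, T], ℝ^k))`. Only the values of `x` on `[0, T]` matter. -/
def MemAddRLIntegral {k : ℕ} (α T : ℝ) (x₀ : E k) (x : ℝ → E k) : Prop :=
  ∃ φ : ℝ → E k, MemLp φ ∞ (segMeasure T) ∧ ∀ t ∈ Icc 0 T, x t = x₀ + rlIntegral α φ t

/-- The left-sided Caputo fractional derivative of order `α` of `x` exists at `t` and equals `d`:
`1 / Γ(1 - α) d/dt ∫₀ᵗ (x(τ) - x(0)) / (t - τ)^α dτ = d`. -/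
def HasCaputoDerivAt {k : ℕ} (α : ℝ) (x : ℝ → E k) (d : E k) (t : ℝ) : Prop :=
  HasDerivAt
    (fun r : ℝ => (1 / Real.Gamma (1 - α)) •
      ∫ τ in (0 : ℝ)..r, (1 / (r - τ) ^ α) • (x τ - x 0)) d t

/-- `x` is a solution on `[0, T]` of the Cauchy problem `(ᶜD^α x)(t) = f(t, x(t))`, `x(0) = x₀`:
it belongs to `{x₀} + I^α (L^∞)` and satisfies the equation almost everywhere on `[0, T]`. -/
def IsCauchySolution {n : ℕ} (α T : ℝ) (f : ℝ → E n → E n) (x₀ : E n) (x : ℝ → E n) : Prop :=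
  MemAddRLIntegral α T x₀ x ∧
    ∀ᵐ t ∂(segMeasure T), HasCaputoDerivAt α x (f t (x t)) t

/-- Admissible realizations: Lebesgue measurable functions `[0, T) → A`.
(For functions with values in a Euclidean space, almost everywhere measurability in Mathlib's
sense is the same as measurability with respect to the Lebesgue measurable sets.) -/
def IsAdmissible {k : ℕ} (T : ℝ) (A : Set (E k)) (w : ℝ → E k) : Prop :=
  AEMeasurable w (volume.restrict (Ico 0 T)) ∧ ∀ t ∈ Ico 0 T, w t ∈ A

section System

variable {n nu nv : ℕ}

/-- `max_{v ∈ Q} ⟨s, g(t, x, u, v)⟩`, as a function of `u`. -/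
def maxOverQ (Q : Set (E nv)) (g : ℝ → E n → E nu → E nv → E n)
    (t : ℝ) (x s : E n) (u : E nu) : ℝ :=
  ⨆ v : Q, inner ℝ s (g t x u v)

/-- `min_{u ∈ P} ⟨s, g(t, x, u, v)⟩`, as a function of `v`. -/
def minOverP (P : Set (E nu)) (g : ℝ → E n → E nu → E nv → E n)
    (t : ℝ) (x s : E n) (v : E nv) : ℝ :=
  ⨅ u : P, inner ℝ s (g t x u v)

/-- The standing conditions on `P`, `Q` and `g : [0, T] × ℝⁿ × P × Q → ℝⁿ`; nothing is asked of
`g` outside this domain. Under the first three conditions all infima and suprema in the last one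
are attained when `P` and `Q` are non-empty. -/
structure IsConflictSystem (T : ℝ) (P : Set (E nu)) (Q : Set (E nv))
    (g : ℝ → E n → E nu → E nv → E n) : Prop where
  compact_P : IsCompact P
  compact_Q : IsCompact Q
  continuousOn :
    ContinuousOn (fun z : ℝ × E n × E nu × E nv => g z.1 z.2.1 z.2.2.1 z.2.2.2)
      (Icc 0 T ×ˢ (univ : Set (E n)) ×ˢ P ×ˢ Q)
  locally_lipschitz : ∀ r : ℝ, 0 ≤ r → ∃ L : ℝ, 0 < L ∧
    ∀ t ∈ Icc 0 T, ∀ x ∈ Metric.closedBall (0 : E n) r, ∀ y ∈ Metric.closedBall (0 : E n) r,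
      ∀ u ∈ P, ∀ v ∈ Q, ‖g t x u v - g t y u v‖ ≤ L * ‖x - y‖
  linear_growth : ∃ c : ℝ, 0 < c ∧
    ∀ t ∈ Icc 0 T, ∀ x : E n, ∀ u ∈ P, ∀ v ∈ Q, ‖g t x u v‖ ≤ (1 + ‖x‖) * c
  saddle_point : ∀ t ∈ Icc 0 T, ∀ x s : E n,
    ⨅ u : P, maxOverQ Q g t x s u = ⨆ v : Q, minOverP P g t x s v

/-- `x` is the motion of `(ᶜD^α x)(t) = g(t, x(t), u(t), v(t))`, `x(0) = x₀`,
that corresponds to the realizations `u` and `v`. -/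
def IsMotion (α T : ℝ) (g : ℝ → E n → E nu → E nv → E n) (x₀ : E n)
    (u : ℝ → E nu) (v : ℝ → E nv) (x : ℝ → E n) : Prop :=
  IsCauchySolution α T (fun t z => g t z (u t) (v t)) x₀ x

/-- A partition `0 = τ₀ < τ₁ < … < τ_k = T` of the segment `[0, T]`. -/
structure TimePartition (T : ℝ) where
  k : ℕ
  node : Fin (k + 1) → ℝ
  strictMono : StrictMono node
  node_zero : node 0 = 0
  node_last : node (Fin.last k) = T

/-- The diameter of a partition: the largest length of one of its intervals. -/
def TimePartition.diam {T : ℝ} (Δ : TimePartition T) : ℝ :=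
  ⨆ j : Fin Δ.k, (Δ.node j.succ - Δ.node j.castSucc)

/-- The set of minimizers of `F` on `A`. -/
def argMin {k : ℕ} (A : Set (E k)) (F : E k → ℝ) : Set (E k) := {a ∈ A | IsMinOn F A a}

/-- The set of maximizers of `F` on `A`. -/
def argMax {k : ℕ} (A : Set (E k)) (F : E k → ℝ) : Set (E k) := {a ∈ A | IsMaxOn F A a}

/-- The control `u` of the system and the control `v'` of the guide are formed by the mutual
aiming procedure on the partition `Δ` along `x` and `y`: on every interval `[τ_j, τ_{j+1})`
each of them is constant and equal to an extremal value at the position at time `τ_j`,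
in the direction `s(τ_j) = x(τ_j) - y(τ_j)`. -/
def IsMutualAiming {T : ℝ} (P : Set (E nu)) (Q : Set (E nv))
    (g : ℝ → E n → E nu → E nv → E n) (Δ : TimePartition T)
    (x y : ℝ → E n) (u : ℝ → E nu) (v' : ℝ → E nv) : Prop :=
  ∀ j : Fin Δ.k,
    let τ := Δ.node j.castSucc
    (∃ uj ∈ argMin P (maxOverQ Q g τ (x τ) (x τ - y τ)),
      ∀ t ∈ Ico τ (Δ.node j.succ), u t = uj) ∧
    (∃ vj ∈ argMax Q (minOverP P g τ (x τ) (x τ - y τ)),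
      ∀ t ∈ Ico τ (Δ.node j.succ), v' t = vj)

end System

end FractionalControl

end

/-!
Let `s = x - y`. The heart of the argument is the energy inequality
`‖s t‖² ≤ ‖s 0‖² + 2 I^α ⟨ᶜD^α s, s⟩ t`. For `s 0 = 0` and `ψ = ᶜD^α s` both sides are quadratic
forms in `f τ = (t - τ)^(α - 1) ψ τ`: after symmetrization the right-hand side has the kernel
`(1 - m)^(-(1 - α))` with `m = min / max` of the two distances to `t`. Expanding in powers of `m`,
all coefficients are nonnegative and every power of `m` is positive semidefinite, so the form is at
least its zeroth term `‖∫ f‖²`.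

Extremal aiming, the saddle point of the small game and the equicontinuity of the motions give
`⟨ᶜD^α s, s⟩ ≤ L ‖s‖² + η` with `η → 0` as the partition is refined, and the fractional Grönwall
inequality, proved with the weight `exp (l t)` where `l^α` is twice the constant, concludes.
-/

namespace FractionalControl

section Kernel

/-- The Riemann-Liouville kernel `r^(α - 1) / Γ(α)`, extended by zero to `r ≤ 0` so that
fractional integrals become convolutions over a domain that does not depend on the end point. -/
noncomputable def rlKernel (α r : ℝ) : ℝ :=
  if 0 < r then r ^ (α - 1) / Real.Gamma α else 0

variable {α β r : ℝ}

lemma rlKernel_of_pos (hr : 0 < r) : rlKernel α r = r ^ (α - 1) / Real.Gamma α := if_pos hr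

lemma rlKernel_of_nonpos (hr : r ≤ 0) : rlKernel α r = 0 := if_neg hr.not_gt

lemma rlKernel_pos (hα : 0 < α) (hr : 0 < r) : 0 < rlKernel α r := by
  rw [rlKernel_of_pos hr]
  exact div_pos (Real.rpow_pos_of_pos hr _) (Real.Gamma_pos_of_pos hα)

lemma rlKernel_nonneg (hα : 0 < α) (r : ℝ) : 0 ≤ rlKernel α r := by
  rcases le_or_gt r 0 with hr | hr
  exacts [(rlKernel_of_nonpos hr).ge, (rlKernel_pos hα hr).le]

lemma rlKernel_one_of_pos (hr : 0 < r) : rlKernel 1 r = 1 := by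
  simp [rlKernel_of_pos hr]

lemma rlKernel_add_one (hα : 0 < α) (r : ℝ) :
    rlKernel (α + 1) r = max r 0 ^ α / Real.Gamma (α + 1) := by
  rcases le_or_gt r 0 with hr | hr
  · rw [rlKernel_of_nonpos hr, max_eq_right hr, Real.zero_rpow hα.ne', zero_div]
  · rw [rlKernel_of_pos hr, max_eq_left hr.le, add_sub_cancel_right]

lemma continuous_rlKernel_add_one (hα : 0 < α) : Continuous (rlKernel (α + 1)) := by
  simp only [funext (rlKernel_add_one hα)]
  exact ((continuous_id.max continuous_const).rpow_const fun _ => .inr hα.le).div_const _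

lemma monotone_rlKernel_add_one (hα : 0 < α) : Monotone (rlKernel (α + 1)) := by
  intro r s hrs
  have := Real.Gamma_pos_of_pos (add_pos hα one_pos)
  simp only [rlKernel_add_one hα]
  gcongr

lemma antitoneOn_rlKernel (hα₀ : 0 < α) (hα₁ : α ≤ 1) : AntitoneOn (rlKernel α) (Ioi 0) := by
  intro r hr s hs hrs
  rw [rlKernel_of_pos hr, rlKernel_of_pos hs]
  have := Real.Gamma_pos_of_pos hα₀
  gcongr ?_ / _
  exact Real.rpow_le_rpow_of_nonpos hr hrs (by linarith)

@[fun_prop]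
lemma measurable_rlKernel (α : ℝ) : Measurable (rlKernel α) :=
  Measurable.ite measurableSet_Ioi (by fun_prop) measurable_const

lemma integrableOn_rlKernel_Iic (hα : 0 < α) (b : ℝ) : IntegrableOn (rlKernel α) (Iic b) := by
  have h_pos : IntegrableOn (rlKernel α) (Ioc 0 b) := by
    rcases le_total b 0 with hb | hb
    · simp [Ioc_eq_empty_of_le hb]
    · have h := (intervalIntegrable_iff_integrableOn_Ioc_of_le hb).1
        (intervalIntegral.intervalIntegrable_rpow' (r := α - 1) (by linarith))
      exact IntegrableOn.congr_fun (h.div_const _) (fun r hr => (rlKernel_of_pos hr.1).symm)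
        measurableSet_Ioc
  refine h_pos.of_forall_sdiff_eq_zero measurableSet_Iic fun r hr => rlKernel_of_nonpos ?_
  exact not_lt.1 fun h => hr.2 ⟨h, hr.1⟩

lemma integrableOn_rlKernel_sub_left (hα : 0 < α) (t a : ℝ) :
    IntegrableOn (fun τ => rlKernel α (t - τ)) (Ici a) := by
  have h_reflect : (Ici a).indicator (fun τ => rlKernel α (t - τ)) =
      fun τ => (Iic (t - a)).indicator (rlKernel α) (t - τ) := by
    ext τ
    simp only [indicator_apply, mem_Ici, mem_Iic, sub_le_sub_iff_left]
  rw [← integrable_indicator_iff measurableSet_Ici, h_reflect]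
  exact ((integrableOn_rlKernel_Iic hα (t - a)).integrable_indicator
    measurableSet_Iic).comp_sub_left t

lemma integral_rpow_mul_sub_rpow (hα : 0 < α) (hβ : 0 < β) {a : ℝ} (ha : 0 < a) :
    ∫ x in (0 : ℝ)..a, x ^ (α - 1) * (a - x) ^ (β - 1) =
      a ^ (α + β - 1) * (Real.Gamma α * Real.Gamma β / Real.Gamma (α + β)) := by
  have h_scaled := Complex.betaIntegral_scaled α β ha
  have h_gamma := Complex.Gamma_mul_Gamma_eq_betaIntegral (s := α) (t := β) (by simpa) (by simpa)
  have h_real : ∫ x in (0 : ℝ)..a, (x : ℂ) ^ ((α : ℂ) - 1) * ((a : ℂ) - x) ^ ((β : ℂ) - 1) =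
      ((∫ x in (0 : ℝ)..a, x ^ (α - 1) * (a - x) ^ (β - 1) : ℝ) : ℂ) := by
    rw [← intervalIntegral.integral_ofReal]
    refine intervalIntegral.integral_congr fun x hx => ?_
    rw [uIcc_of_le ha.le] at hx
    simp only [Complex.ofReal_mul, Complex.ofReal_cpow hx.1,
      Complex.ofReal_cpow (sub_nonneg.2 hx.2), Complex.ofReal_sub, Complex.ofReal_one]
  have h_ne : (Real.Gamma (α + β) : ℂ) ≠ 0 :=
    Complex.ofReal_ne_zero.2 (Real.Gamma_pos_of_pos (add_pos hα hβ)).ne'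
  have h_pow : (a : ℂ) ^ ((α : ℂ) + β - 1) = ((a ^ (α + β - 1) : ℝ) : ℂ) := by
    rw [Complex.ofReal_cpow ha.le]
    push_cast
    rfl
  rw [← Complex.ofReal_add, Complex.Gamma_ofReal, Complex.Gamma_ofReal, Complex.Gamma_ofReal,
    mul_comm (Real.Gamma (α + β) : ℂ), ← div_eq_iff h_ne] at h_gamma
  rw [h_real, h_pow, ← h_gamma] at h_scaled
  exact_mod_cast h_scaled

lemma integral_rlKernel_mul_rlKernel (hα : 0 < α) (hβ : 0 < β) (t a : ℝ) :
    ∫ τ, rlKernel β (t - τ) * rlKernel α (τ - a) = rlKernel (α + β) (t - a) := by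
  have h_shift := integral_sub_right_eq_self
    (fun τ => rlKernel β (t - a - τ) * rlKernel α τ) (μ := volume) a
  simp only [sub_sub_sub_cancel_right] at h_shift
  rw [h_shift]
  set d := t - a
  have h_supp : ∫ τ, rlKernel β (d - τ) * rlKernel α τ =
      ∫ τ in Ioo 0 d, rlKernel β (d - τ) * rlKernel α τ := by
    refine (setIntegral_eq_integral_of_forall_compl_eq_zero fun τ hτ => ?_).symm
    rcases le_or_gt τ 0 with h | h
    · rw [rlKernel_of_nonpos h, mul_zero]
    · rw [rlKernel_of_nonpos (sub_nonpos.2 (not_lt.1 fun h' => hτ ⟨h, h'⟩)), zero_mul]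
  rw [h_supp]
  rcases le_or_gt d 0 with hd | hd
  · simp [Ioo_eq_empty_of_le hd, rlKernel_of_nonpos hd]
  · have h_congr : EqOn (fun τ => rlKernel β (d - τ) * rlKernel α τ)
        (fun τ => (Real.Gamma α * Real.Gamma β)⁻¹ * (τ ^ (α - 1) * (d - τ) ^ (β - 1)))
        (Ioo 0 d) := fun τ hτ => by
      simp only [rlKernel_of_pos hτ.1, rlKernel_of_pos (sub_pos.2 hτ.2)]
      ring
    have hΓα := (Real.Gamma_pos_of_pos hα).ne'
    have hΓβ := (Real.Gamma_pos_of_pos hβ).ne'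
    rw [setIntegral_congr_fun measurableSet_Ioo h_congr, integral_const_mul,
      ← integral_Ioc_eq_integral_Ioo, ← intervalIntegral.integral_of_le hd.le,
      integral_rpow_mul_sub_rpow hα hβ hd, rlKernel_of_pos hd]
    field_simp

lemma integral_Ici_rlKernel_sub_left (hα : 0 < α) (t a : ℝ) :
    ∫ τ in Ici a, rlKernel α (t - τ) = rlKernel (α + 1) (t - a) := by
  rw [add_comm, ← integral_rlKernel_mul_rlKernel one_pos hα t a, integral_Ici_eq_integral_Ioi,
    ← integral_indicator measurableSet_Ioi]
  congr 1 with τ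
  by_cases hτ : a < τ
  · rw [indicator_of_mem (mem_Ioi.2 hτ), rlKernel_one_of_pos (sub_pos.2 hτ), mul_one]
  · rw [indicator_of_notMem (notMem_Ioi.2 (not_lt.1 hτ)),
      rlKernel_of_nonpos (sub_nonpos.2 (not_lt.1 hτ)), mul_zero]

end Kernel

section FractionalIntegral

/-- The fractional integral of order `α` with lower limit `0`, as a convolution with `rlKernel α`
over `[0, ∞)`: it is `rlIntegral` for functions with values in an arbitrary normed space. -/
noncomputable def fracIntegral {F : Type*} [NormedAddCommGroup F] [NormedSpace ℝ F]
    (α : ℝ) (φ : ℝ → F) (t : ℝ) : F :=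
  ∫ τ in Ici 0, rlKernel α (t - τ) • φ τ

variable {F : Type*} [NormedAddCommGroup F] [NormedSpace ℝ F] {α β t T : ℝ} {φ ψ : ℝ → F}

lemma fracIntegral_eq_setIntegral_Ioo (α : ℝ) (φ : ℝ → F) (t : ℝ) :
    fracIntegral α φ t = ∫ τ in Ioo 0 t, rlKernel α (t - τ) • φ τ := by
  rw [← integral_Ico_eq_integral_Ioo]
  refine setIntegral_eq_of_subset_of_forall_sdiff_eq_zero measurableSet_Ici Ico_subset_Ici_self
    fun τ hτ => ?_
  rw [rlKernel_of_nonpos (sub_nonpos.2 (not_lt.1 fun h => hτ.2 ⟨hτ.1, h⟩)), zero_smul]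

lemma rlIntegral_eq_fracIntegral {k : ℕ} (α : ℝ) (φ : ℝ → E k) {t : ℝ} (ht : 0 ≤ t) :
    rlIntegral α φ t = fracIntegral α φ t := by
  rw [fracIntegral_eq_setIntegral_Ioo, rlIntegral, intervalIntegral.integral_of_le ht,
    integral_Ioc_eq_integral_Ioo, ← integral_smul]
  refine setIntegral_congr_fun measurableSet_Ioo fun τ hτ => ?_
  have h_pos : 0 < t - τ := sub_pos.2 hτ.2
  simp only [rlKernel_of_pos h_pos, smul_smul]
  rw [← neg_sub 1 α, Real.rpow_neg h_pos.le]
  congr 1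
  ring

lemma fracIntegral_one (φ : ℝ → F) (ht : 0 ≤ t) : fracIntegral 1 φ t = ∫ τ in (0 : ℝ)..t, φ τ := by
  rw [fracIntegral_eq_setIntegral_Ioo, intervalIntegral.integral_of_le ht,
    integral_Ioc_eq_integral_Ioo]
  refine setIntegral_congr_fun measurableSet_Ioo fun τ hτ => ?_
  simp only [rlKernel_one_of_pos (sub_pos.2 hτ.2), one_smul]

lemma fracIntegral_eq_integral_segMeasure (ht : t ≤ T) :
    fracIntegral α φ t = ∫ τ, rlKernel α (t - τ) • φ τ ∂segMeasure T := by
  refine setIntegral_eq_of_subset_of_forall_sdiff_eq_zero measurableSet_Ici Icc_subset_Ici_self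
    fun τ hτ => ?_
  have : t ≤ τ := ht.trans (not_le.1 fun h => hτ.2 ⟨hτ.1, h⟩).le
  rw [rlKernel_of_nonpos (sub_nonpos.2 this), zero_smul]

lemma fracIntegral_congr_ae (ht : t ≤ T) (h : φ =ᵐ[segMeasure T] ψ) :
    fracIntegral α φ t = fracIntegral α ψ t := by
  simp only [fracIntegral_eq_integral_segMeasure ht]
  exact integral_congr_ae (h.mono fun τ hτ => by simp only [hτ])

lemma fracIntegral_const [CompleteSpace F] (hα : 0 < α) (c : F) (t : ℝ) :
    fracIntegral α (fun _ => c) t = rlKernel (α + 1) t • c := by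
  rw [fracIntegral, integral_smul_const, integral_Ici_rlKernel_sub_left hα, sub_zero]

lemma fracIntegral_const_mul (c : ℝ) (w : ℝ → ℝ) (t : ℝ) :
    fracIntegral α (fun τ => c * w τ) t = c * fracIntegral α w t := by
  simp only [fracIntegral, smul_eq_mul, mul_left_comm _ c, integral_const_mul]

lemma integrable_rlKernel_sub_left (hα : 0 < α) (t T : ℝ) :
    Integrable (fun τ => rlKernel α (t - τ)) (segMeasure T) :=
  (integrableOn_rlKernel_sub_left hα t 0).mono_set Icc_subset_Ici_self

lemma integrable_rlKernel_sub_left_smul (hα : 0 < α) (hφ : MemLp φ ∞ (segMeasure T)) (t : ℝ) :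
    Integrable (fun τ => rlKernel α (t - τ) • φ τ) (segMeasure T) :=
  (integrable_rlKernel_sub_left hα t T).smul_of_top_left hφ

lemma fracIntegral_add (hα : 0 < α) (hφ : MemLp φ ∞ (segMeasure T))
    (hψ : MemLp ψ ∞ (segMeasure T)) (ht : t ≤ T) :
    fracIntegral α (fun τ => φ τ + ψ τ) t = fracIntegral α φ t + fracIntegral α ψ t := by
  simp only [fracIntegral_eq_integral_segMeasure ht, smul_add]
  exact integral_add (integrable_rlKernel_sub_left_smul hα hφ t)
    (integrable_rlKernel_sub_left_smul hα hψ t)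

lemma fracIntegral_sub (hα : 0 < α) (hφ : MemLp φ ∞ (segMeasure T))
    (hψ : MemLp ψ ∞ (segMeasure T)) (ht : t ≤ T) :
    fracIntegral α (fun τ => φ τ - ψ τ) t = fracIntegral α φ t - fracIntegral α ψ t := by
  simp only [fracIntegral_eq_integral_segMeasure ht, smul_sub]
  exact integral_sub (integrable_rlKernel_sub_left_smul hα hφ t)
    (integrable_rlKernel_sub_left_smul hα hψ t)

lemma fracIntegral_mono_ae (hα : 0 < α) {v w : ℝ → ℝ} (hv : MemLp v ∞ (segMeasure T))
    (hw : MemLp w ∞ (segMeasure T)) (h : v ≤ᵐ[segMeasure T] w) (ht : t ≤ T) :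
    fracIntegral α v t ≤ fracIntegral α w t := by
  simp only [fracIntegral_eq_integral_segMeasure ht]
  exact integral_mono_ae (integrable_rlKernel_sub_left_smul hα hv t)
    (integrable_rlKernel_sub_left_smul hα hw t)
    (h.mono fun τ hτ => mul_le_mul_of_nonneg_left hτ (rlKernel_nonneg hα _))

lemma norm_fracIntegral_le (hα : 0 < α) (φ : ℝ → F) (t : ℝ) :
    ‖fracIntegral α φ t‖ ≤ fracIntegral α (fun τ => ‖φ τ‖) t := by
  refine (norm_integral_le_integral_norm _).trans_eq (integral_congr_ae (.of_forall fun τ => ?_))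
  simp only [norm_smul, Real.norm_of_nonneg (rlKernel_nonneg hα _), smul_eq_mul]

lemma abs_rlKernel_sub_le (hα₀ : 0 < α) (hα₁ : α ≤ 1) {r : ℝ} (hrt : r ≤ t) (τ : ℝ) :
    |rlKernel α (t - τ) - rlKernel α (r - τ)| ≤ rlKernel α (r - τ) - rlKernel α (t - τ) +
      2 * (Ici r).indicator (fun τ => rlKernel α (t - τ)) τ := by
  rcases lt_or_ge τ r with hτ | hτ
  · have h_anti : rlKernel α (t - τ) ≤ rlKernel α (r - τ) :=
      antitoneOn_rlKernel hα₀ hα₁ (sub_pos.2 hτ) (sub_pos.2 (hτ.trans_le hrt)) (by linarith)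
    rw [abs_of_nonpos (sub_nonpos.2 h_anti), indicator_of_notMem (notMem_Ici.2 hτ)]
    linarith
  · rw [rlKernel_of_nonpos (sub_nonpos.2 hτ), sub_zero, abs_of_nonneg (rlKernel_nonneg hα₀ _),
      indicator_of_mem (mem_Ici.2 hτ)]
    linarith

lemma integral_abs_rlKernel_sub_le (hα₀ : 0 < α) (hα₁ : α ≤ 1) {r : ℝ} (hr : 0 ≤ r) (hrt : r ≤ t) :
    ∫ τ in Ici 0, |rlKernel α (t - τ) - rlKernel α (r - τ)| ≤ 2 * rlKernel (α + 1) (t - r) := by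
  have h_t := integrableOn_rlKernel_sub_left hα₀ t 0
  have h_r := integrableOn_rlKernel_sub_left hα₀ r 0
  have h_ind : IntegrableOn ((Ici r).indicator fun τ => rlKernel α (t - τ)) (Ici 0) :=
    h_t.indicator measurableSet_Ici
  have h_tail : ∫ τ in Ici 0, (Ici r).indicator (fun τ => rlKernel α (t - τ)) τ =
      rlKernel (α + 1) (t - r) := by
    rw [setIntegral_indicator measurableSet_Ici, Ici_inter_Ici, sup_eq_right.2 hr,
      integral_Ici_rlKernel_sub_left hα₀]
  calc ∫ τ in Ici 0, |rlKernel α (t - τ) - rlKernel α (r - τ)|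
      ≤ ∫ τ in Ici 0, (rlKernel α (r - τ) - rlKernel α (t - τ) +
          2 * (Ici r).indicator (fun τ => rlKernel α (t - τ)) τ) :=
        integral_mono (h_t.sub h_r).abs ((h_r.sub h_t).add (h_ind.const_mul 2))
          (abs_rlKernel_sub_le hα₀ hα₁ hrt)
    _ = rlKernel (α + 1) r - rlKernel (α + 1) t + 2 * rlKernel (α + 1) (t - r) := by
        rw [integral_add (by exact h_r.sub h_t) (h_ind.const_mul 2), integral_sub h_r h_t,
          integral_const_mul, h_tail]
        simp only [integral_Ici_rlKernel_sub_left hα₀, sub_zero]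
    _ ≤ 2 * rlKernel (α + 1) (t - r) := by
        linarith [monotone_rlKernel_add_one hα₀ hrt]

lemma norm_fracIntegral_sub_le (hα₀ : 0 < α) (hα₁ : α ≤ 1) (hφ : MemLp φ ∞ (segMeasure T))
    {C : ℝ} (hC₀ : 0 ≤ C) (hC : ∀ᵐ τ ∂segMeasure T, ‖φ τ‖ ≤ C) {r : ℝ} (hr : 0 ≤ r) (hrt : r ≤ t)
    (ht : t ≤ T) :
    ‖fracIntegral α φ t - fracIntegral α φ r‖ ≤ 2 * C * rlKernel (α + 1) (t - r) := by
  set d : ℝ → ℝ := fun τ => |rlKernel α (t - τ) - rlKernel α (r - τ)|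
  have h_d : IntegrableOn d (Ici 0) :=
    ((integrableOn_rlKernel_sub_left hα₀ t 0).sub (integrableOn_rlKernel_sub_left hα₀ r 0)).abs
  rw [fracIntegral_eq_integral_segMeasure ht, fracIntegral_eq_integral_segMeasure (hrt.trans ht),
    ← integral_sub (integrable_rlKernel_sub_left_smul hα₀ hφ t)
      (integrable_rlKernel_sub_left_smul hα₀ hφ r)]
  calc ‖∫ τ, (rlKernel α (t - τ) • φ τ - rlKernel α (r - τ) • φ τ) ∂segMeasure T‖
      ≤ ∫ τ, d τ * C ∂segMeasure T := by
        refine norm_integral_le_of_norm_le ((h_d.mono_set Icc_subset_Ici_self).mul_const C) ?_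
        filter_upwards [hC] with τ hτ
        rw [← sub_smul, norm_smul]
        exact mul_le_mul_of_nonneg_left hτ (abs_nonneg _)
    _ ≤ (∫ τ in Ici 0, d τ) * C := by
        rw [integral_mul_const]
        exact mul_le_mul_of_nonneg_right (setIntegral_mono_set h_d
          (.of_forall fun _ => abs_nonneg _) Icc_subset_Ici_self.eventuallyLE) hC₀
    _ ≤ 2 * C * rlKernel (α + 1) (t - r) := by
        linarith [mul_le_mul_of_nonneg_right (integral_abs_rlKernel_sub_le hα₀ hα₁ hr hrt) hC₀]

lemma continuousOn_fracIntegral (hα₀ : 0 < α) (hα₁ : α ≤ 1) (hφ : MemLp φ ∞ (segMeasure T)) :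
    ContinuousOn (fracIntegral α φ) (Icc 0 T) := by
  set C := lpNorm φ ∞ (segMeasure T)
  have h_bound : ∀ᵐ τ ∂segMeasure T, ‖φ τ‖ ≤ C := ae_le_lpNorm_exponent_top hφ
  have h_mod : ∀ r ∈ Icc 0 T, ∀ t ∈ Icc 0 T,
      dist (fracIntegral α φ t) (fracIntegral α φ r) ≤ 2 * C * rlKernel (α + 1) |t - r| := by
    intro r hr t ht
    rcases le_total r t with h | h
    · rw [dist_eq_norm, abs_of_nonneg (sub_nonneg.2 h)]
      exact norm_fracIntegral_sub_le hα₀ hα₁ hφ lpNorm_nonneg h_bound hr.1 h ht.2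
    · rw [dist_comm, dist_eq_norm, abs_sub_comm, abs_of_nonneg (sub_nonneg.2 h)]
      exact norm_fracIntegral_sub_le hα₀ hα₁ hφ lpNorm_nonneg h_bound ht.1 h hr.2
  intro r hr
  have h_lim : Filter.Tendsto (fun t => 2 * C * rlKernel (α + 1) |t - r|) (nhdsWithin r (Icc 0 T))
      (nhds 0) := by
    have h_cont : Continuous fun t => 2 * C * rlKernel (α + 1) |t - r| :=
      continuous_const.mul ((continuous_rlKernel_add_one hα₀).comp (by fun_prop))
    simpa [rlKernel_of_nonpos] using (h_cont.continuousWithinAt (s := Icc 0 T) (x := r)).tendsto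
  refine tendsto_iff_dist_tendsto_zero.2 (squeeze_zero' (.of_forall fun _ => dist_nonneg) ?_ h_lim)
  filter_upwards [self_mem_nhdsWithin] with t ht using h_mod r hr t ht

end FractionalIntegral

section Semigroup

variable {F : Type*} [NormedAddCommGroup F] {α β t T : ℝ}

lemma ae_segMeasure_mem_Icc (T : ℝ) : ∀ᵐ t ∂segMeasure T, t ∈ Icc 0 T :=
  ae_restrict_mem measurableSet_Icc

lemma memLp_top_of_continuousOn {w : ℝ → F} (hw : ContinuousOn w (Icc 0 T)) :
    MemLp w ∞ (segMeasure T) := by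
  obtain ⟨C, hC⟩ := isCompact_Icc.exists_bound_of_continuousOn hw
  exact memLp_top_of_bound (hw.aestronglyMeasurable measurableSet_Icc) C
    ((ae_segMeasure_mem_Icc T).mono hC)

lemma integrable_prod_mul_rlKernel (hα : 0 < α) {u : ℝ → ℝ} (hu : Integrable u (segMeasure T)) :
    Integrable (fun z : ℝ × ℝ => u z.1 * rlKernel α (z.1 - z.2))
      ((segMeasure T).prod (segMeasure T)) := by
  have h_meas : AEStronglyMeasurable (fun z : ℝ × ℝ => u z.1 * rlKernel α (z.1 - z.2))
      ((segMeasure T).prod (segMeasure T)) :=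
    hu.aestronglyMeasurable.comp_fst.mul
      ((measurable_rlKernel α).comp (measurable_fst.sub measurable_snd)).aestronglyMeasurable
  have h_norm : ∀ t ∈ Icc 0 T, ∫ τ, ‖u t * rlKernel α (t - τ)‖ ∂segMeasure T =
      ‖u t‖ * rlKernel (α + 1) t := by
    intro t ht
    have h_const := fracIntegral_const hα (1 : ℝ) t
    rw [fracIntegral_eq_integral_segMeasure ht.2] at h_const
    simp only [smul_eq_mul, mul_one] at h_const
    simp only [norm_mul, Real.norm_of_nonneg (rlKernel_nonneg hα _), integral_const_mul, h_const]
  refine (integrable_prod_iff h_meas).2 ⟨.of_forall fun t =>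
    (integrable_rlKernel_sub_left hα t T).const_mul (u t), ?_⟩
  refine (hu.norm.mul_of_top_left (memLp_top_of_continuousOn
    (continuous_rlKernel_add_one hα).continuousOn)).congr ?_
  filter_upwards [ae_segMeasure_mem_Icc T] with t ht using (h_norm t ht).symm

lemma setIntegral_Icc_rlKernel_mul_rlKernel (hα : 0 < α) (hβ : 0 < β) {σ : ℝ} (hσ : 0 ≤ σ)
    (ht : t ≤ T) :
    ∫ τ in Icc 0 T, rlKernel β (t - τ) * rlKernel α (τ - σ) = rlKernel (α + β) (t - σ) := by
  rw [← integral_rlKernel_mul_rlKernel hα hβ]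
  refine setIntegral_eq_integral_of_forall_compl_eq_zero fun τ hτ => ?_
  rcases lt_or_ge τ 0 with h | h
  · rw [rlKernel_of_nonpos (by linarith : τ - σ ≤ 0), mul_zero]
  · have h_T : T < τ := not_le.1 fun h' => hτ ⟨h, h'⟩
    rw [rlKernel_of_nonpos (by linarith : t - τ ≤ 0), zero_mul]

lemma fracIntegral_fracIntegral [NormedSpace ℝ F] [CompleteSpace F] (hα : 0 < α) (hβ : 0 < β)
    {φ : ℝ → F} (hφ : MemLp φ ∞ (segMeasure T)) (ht : t ≤ T) :
    fracIntegral β (fracIntegral α φ) t = fracIntegral (α + β) φ t := by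
  have h_int : Integrable (fun z : ℝ × ℝ => (rlKernel β (t - z.1) * rlKernel α (z.1 - z.2)) • φ z.2)
      ((segMeasure T).prod (segMeasure T)) :=
    (integrable_prod_mul_rlKernel hα (integrable_rlKernel_sub_left hβ t T)).smul_of_top_left
      (hφ.comp_snd _)
  calc fracIntegral β (fracIntegral α φ) t
      = ∫ τ, ∫ σ, (rlKernel β (t - τ) * rlKernel α (τ - σ)) • φ σ ∂segMeasure T ∂segMeasure T := by
        rw [fracIntegral_eq_integral_segMeasure ht]
        refine integral_congr_ae ?_
        filter_upwards [ae_segMeasure_mem_Icc T] with τ hτ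
        simp only [fracIntegral_eq_integral_segMeasure hτ.2, mul_smul, integral_smul]
    _ = ∫ σ, ∫ τ, (rlKernel β (t - τ) * rlKernel α (τ - σ)) • φ σ ∂segMeasure T ∂segMeasure T :=
        integral_integral_swap h_int
    _ = fracIntegral (α + β) φ t := by
        rw [fracIntegral_eq_integral_segMeasure ht]
        refine integral_congr_ae ?_
        filter_upwards [ae_segMeasure_mem_Icc T] with σ hσ
        rw [integral_smul_const, setIntegral_Icc_rlKernel_mul_rlKernel hα hβ hσ.1 ht]

end Semigroup

section Gronwall

variable {α T : ℝ}

lemma integral_rlKernel_mul_exp_neg (hα : 0 < α) {l : ℝ} (hl : 0 < l) :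
    ∫ r, rlKernel α r * Real.exp (-(l * r)) = l ^ (-α) := by
  have h_supp : ∫ r, rlKernel α r * Real.exp (-(l * r)) =
      ∫ r in Ioi 0, rlKernel α r * Real.exp (-(l * r)) :=
    (setIntegral_eq_integral_of_forall_compl_eq_zero fun r hr => by
      rw [rlKernel_of_nonpos (not_lt.1 hr), zero_mul]).symm
  have h_congr : EqOn (fun r => rlKernel α r * Real.exp (-(l * r)))
      (fun r => (Real.Gamma α)⁻¹ * (r ^ (α - 1) * Real.exp (-(l * r)))) (Ioi 0) := fun r hr => by
    simp only [rlKernel_of_pos hr]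
    ring
  rw [h_supp, setIntegral_congr_fun measurableSet_Ioi h_congr, integral_const_mul,
    Real.integral_rpow_mul_exp_neg_mul_Ioi hα hl, one_div, Real.inv_rpow hl.le, Real.rpow_neg hl.le]
  have := (Real.Gamma_pos_of_pos hα).ne'
  field_simp

lemma fracIntegral_exp_le (hα : 0 < α) {l : ℝ} (hl : 0 < l) (t : ℝ) :
    fracIntegral α (fun τ => Real.exp (l * τ)) t ≤ l ^ (-α) * Real.exp (l * t) := by
  have h_int : Integrable fun τ => rlKernel α (t - τ) * Real.exp (-(l * (t - τ))) :=
    (Integrable.of_integral_ne_zero (integral_rlKernel_mul_exp_neg hα hl ▸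
      (Real.rpow_pos_of_pos hl _).ne')).comp_sub_left t
  calc fracIntegral α (fun τ => Real.exp (l * τ)) t
      = (∫ τ in Ici 0, rlKernel α (t - τ) * Real.exp (-(l * (t - τ)))) * Real.exp (l * t) := by
        rw [fracIntegral, ← integral_mul_const]
        refine integral_congr_ae (.of_forall fun τ => ?_)
        simp only [smul_eq_mul, mul_assoc, ← Real.exp_add]
        ring_nf
    _ ≤ (∫ τ, rlKernel α (t - τ) * Real.exp (-(l * (t - τ)))) * Real.exp (l * t) := by
        refine mul_le_mul_of_nonneg_right (setIntegral_le_integral h_int (.of_forall fun τ => ?_))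
          (Real.exp_nonneg _)
        exact mul_nonneg (rlKernel_nonneg hα _) (Real.exp_nonneg _)
    _ = l ^ (-α) * Real.exp (l * t) := by
        rw [integral_sub_left_eq_self (fun r => rlKernel α r * Real.exp (-(l * r))),
          integral_rlKernel_mul_exp_neg hα hl]

lemma le_mul_exp_of_le_add_fracIntegral (hα : 0 < α) {A B : ℝ} (hA : 0 ≤ A) (hB : 0 < B)
    {w : ℝ → ℝ} (hw : ContinuousOn w (Icc 0 T))
    (hle : ∀ t ∈ Icc 0 T, w t ≤ A + B * fracIntegral α w t) {t : ℝ} (ht : t ∈ Icc 0 T) :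
    w t ≤ 2 * A * Real.exp ((2 * B) ^ (1 / α) * t) := by
  set l := (2 * B) ^ (1 / α)
  have hl : 0 < l := Real.rpow_pos_of_pos (by positivity) _
  have h_half : B * l ^ (-α) = 1 / 2 := by
    rw [← Real.rpow_mul (by positivity), mul_neg, one_div_mul_cancel hα.ne', Real.rpow_neg_one]
    field_simp
  have h_exp : Continuous fun τ => Real.exp (l * τ) := by fun_prop
  obtain ⟨r, hr, h_max⟩ := isCompact_Icc.exists_isMaxOn ⟨t, ht⟩
    (hw.div h_exp.continuousOn fun τ _ => (Real.exp_pos (l * τ)).ne')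
  set M := w r / Real.exp (l * r)
  have hwr : w r = M * Real.exp (l * r) := (div_mul_cancel₀ _ (Real.exp_pos _).ne').symm
  have h_le : ∀ τ ∈ Icc 0 T, w τ ≤ M * Real.exp (l * τ) := fun τ hτ =>
    (div_le_iff₀ (Real.exp_pos _)).1 (h_max hτ)
  have hM : M ≤ 2 * A := by
    rcases le_or_gt M 0 with hM | hM
    · linarith
    · have h_frac : fracIntegral α w r ≤ M * (l ^ (-α) * Real.exp (l * r)) := by
        refine (fracIntegral_mono_ae hα (memLp_top_of_continuousOn hw)
          (memLp_top_of_continuousOn (h_exp.continuousOn.const_mul M))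
          ((ae_segMeasure_mem_Icc T).mono h_le) hr.2).trans ?_
        rw [fracIntegral_const_mul]
        exact mul_le_mul_of_nonneg_left (fracIntegral_exp_le hα hl r) hM.le
      have h_contr : B * (M * (l ^ (-α) * Real.exp (l * r))) = w r / 2 := by
        rw [hwr]
        linear_combination M * Real.exp (l * r) * h_half
      have h_wr : w r ≤ 2 * A := by
        linarith [hle r hr, mul_le_mul_of_nonneg_left h_frac hB.le]
      have h_one : 1 ≤ Real.exp (l * r) := Real.one_le_exp (mul_nonneg hl.le hr.1)
      exact (le_mul_of_one_le_right hM.le h_one).trans (hwr ▸ h_wr)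
  exact (h_le t ht).trans (by gcongr)

end Gronwall

section PositiveSemidefinite

/-- The kernel `min s t / max s t`, which is positive semidefinite on `(0, ∞)`. -/
noncomputable def minDivMax (s t : ℝ) : ℝ := min s t / max s t

variable {s t : ℝ}

lemma minDivMax_comm (s t : ℝ) : minDivMax s t = minDivMax t s := by
  rw [minDivMax, minDivMax, min_comm, max_comm]

lemma minDivMax_of_le (h : s ≤ t) : minDivMax s t = s / t := by
  rw [minDivMax, min_eq_left h, max_eq_right h]

lemma minDivMax_nonneg (hs : 0 ≤ s) (ht : 0 ≤ t) : 0 ≤ minDivMax s t :=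
  div_nonneg (le_min hs ht) (hs.trans (le_max_left _ _))

lemma minDivMax_pos (hs : 0 < s) (ht : 0 < t) : 0 < minDivMax s t :=
  div_pos (lt_min hs ht) (hs.trans_le (le_max_left _ _))

lemma minDivMax_le_one (hs : 0 ≤ s) : minDivMax s t ≤ 1 :=
  div_le_one_of_le₀ min_le_max (hs.trans (le_max_left _ _))

lemma minDivMax_lt_one (hs : 0 < s) (hne : s ≠ t) : minDivMax s t < 1 :=
  (div_lt_one (hs.trans_le (le_max_left _ _))).2 (min_lt_max.2 hne)

lemma minDivMax_pow (hs : 0 ≤ s) (ht : 0 ≤ t) (n : ℕ) :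
    minDivMax (s ^ n) (t ^ n) = minDivMax s t ^ n := by
  wlog h : s ≤ t generalizing s t
  · rw [minDivMax_comm, minDivMax_comm s, this ht hs (le_of_not_ge h)]
  rw [minDivMax_of_le h, minDivMax_of_le (pow_le_pow_left₀ hs h n), div_pow]

@[fun_prop]
lemma measurable_minDivMax : Measurable fun z : ℝ × ℝ => minDivMax z.1 z.2 := by
  unfold minDivMax
  fun_prop

/-- The functions `s⁻¹ 1_{z ≤ s²}` of `z > 0`, whose Gram matrix in `L²(0, ∞)` is `minDivMax`. -/
noncomputable def minDivMaxFactor (s z : ℝ) : ℝ := if z ≤ s ^ 2 then s⁻¹ else 0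

lemma minDivMaxFactor_nonneg (hs : 0 ≤ s) (z : ℝ) : 0 ≤ minDivMaxFactor s z := by
  unfold minDivMaxFactor
  split_ifs <;> positivity

lemma minDivMaxFactor_le (hs : 0 < s) {z : ℝ} (hz : 0 < z) : minDivMaxFactor s z ≤ (√z)⁻¹ := by
  unfold minDivMaxFactor
  split_ifs with h
  · exact inv_anti₀ (Real.sqrt_pos.2 hz) ((Real.sqrt_le_left hs.le).2 h)
  · positivity

@[fun_prop]
lemma measurable_minDivMaxFactor : Measurable fun w : ℝ × ℝ => minDivMaxFactor w.1 w.2 :=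
  Measurable.ite (measurableSet_le measurable_snd (measurable_fst.pow_const 2))
    measurable_fst.inv measurable_const

lemma integral_minDivMaxFactor_mul (hs : 0 < s) (ht : 0 < t) :
    ∫ z in Ioi 0, minDivMaxFactor s z * minDivMaxFactor t z = minDivMax s t := by
  wlog h : s ≤ t generalizing s t
  · simp only [minDivMax_comm s, ← this ht hs (le_of_not_ge h), mul_comm]
  have h_ind : (fun z => minDivMaxFactor s z * minDivMaxFactor t z) =
      (Iic (s ^ 2)).indicator fun _ => s⁻¹ * t⁻¹ := by
    ext z
    by_cases hz : z ≤ s ^ 2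
    · have hz' : z ≤ t ^ 2 := hz.trans (by gcongr)
      simp [minDivMaxFactor, hz, hz']
    · simp [minDivMaxFactor, hz]
  rw [h_ind, setIntegral_indicator measurableSet_Iic, Ioi_inter_Iic, setIntegral_const,
    Real.volume_real_Ioc_of_le (by positivity), minDivMax_of_le h, smul_eq_mul]
  field_simp
  ring

lemma integrableOn_minDivMaxFactor_mul (hs : 0 < s) (ht : 0 < t) :
    IntegrableOn (fun z => minDivMaxFactor s z * minDivMaxFactor t z) (Ioi 0) :=
  .of_integral_ne_zero (integral_minDivMaxFactor_mul hs ht ▸ (minDivMax_pos hs ht).ne')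

variable {X F : Type*} [MeasurableSpace X] {μ : Measure X}
  [NormedAddCommGroup F] [InnerProductSpace ℝ F]

lemma real_inner_smul_smul (c d : ℝ) (x y : F) :
    inner ℝ (c • x) (d • y) = c * d * inner ℝ x y := by
  rw [real_inner_smul_left, real_inner_smul_right, mul_assoc]

lemma ae_prod_and_of_ae {p : X → Prop} (h : ∀ᵐ x ∂μ, p x) :
    ∀ᵐ w ∂μ.prod μ, p w.1 ∧ p w.2 :=
  (Measure.quasiMeasurePreserving_fst.ae h).and (Measure.quasiMeasurePreserving_snd.ae h)

variable {a : X → ℝ} {f : X → F}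

lemma integrable_prod_inner (hf : Integrable f μ) :
    Integrable (fun w : X × X => inner ℝ (f w.1) (f w.2)) (μ.prod μ) :=
  (hf.norm.mul_prod hf.norm).mono'
    (hf.aestronglyMeasurable.comp_fst.inner hf.aestronglyMeasurable.comp_snd)
    (.of_forall fun _ => norm_inner_le_norm _ _)

lemma integrable_minDivMax_pow_mul_inner (ha : Measurable a) (ha_pos : ∀ᵐ x ∂μ, 0 < a x)
    (hf : Integrable f μ) (n : ℕ) :
    Integrable (fun w : X × X => minDivMax (a w.1) (a w.2) ^ n * inner ℝ (f w.1) (f w.2))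
      (μ.prod μ) := by
  refine (integrable_prod_inner hf).bdd_mul (c := 1)
    (by fun_prop : Measurable _).aestronglyMeasurable ?_
  filter_upwards [ae_prod_and_of_ae ha_pos] with w hw
  have h_nonneg := minDivMax_nonneg hw.1.le hw.2.le
  rw [Real.norm_of_nonneg (pow_nonneg h_nonneg n)]
  exact pow_le_one₀ h_nonneg (minDivMax_le_one hw.1.le)

lemma integrable_inner_minDivMaxFactor_smul (ha : Measurable a) (ha_pos : ∀ᵐ x ∂μ, 0 < a x)
    (hf : Integrable f μ) :
    Integrable (fun w : (X × X) × ℝ => inner ℝ (minDivMaxFactor (a w.1.1) w.2 • f w.1.1)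
      (minDivMaxFactor (a w.1.2) w.2 • f w.1.2)) ((μ.prod μ).prod (volume.restrict (Ioi 0))) := by
  have h_meas : AEStronglyMeasurable (fun w : (X × X) × ℝ =>
      minDivMaxFactor (a w.1.1) w.2 * minDivMaxFactor (a w.1.2) w.2 * inner ℝ (f w.1.1) (f w.1.2))
      ((μ.prod μ).prod (volume.restrict (Ioi 0))) := by
    refine AEStronglyMeasurable.mul (Measurable.aestronglyMeasurable ?_)
      (integrable_prod_inner hf).aestronglyMeasurable.comp_fst
    fun_prop
  simp only [real_inner_smul_smul]
  refine (integrable_prod_iff h_meas).2 ⟨?_, ?_⟩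
  · filter_upwards [ae_prod_and_of_ae ha_pos] with w hw
    exact (integrableOn_minDivMaxFactor_mul hw.1 hw.2).mul_const _
  · refine (integrable_minDivMax_pow_mul_inner ha ha_pos hf 1).norm.congr ?_
    filter_upwards [ae_prod_and_of_ae ha_pos] with w hw
    have h_nonneg (z : ℝ) :
        0 ≤ minDivMaxFactor (a w.1) z * minDivMaxFactor (a w.2) z :=
      mul_nonneg (minDivMaxFactor_nonneg hw.1.le z) (minDivMaxFactor_nonneg hw.2.le z)
    simp only [norm_mul _ (inner ℝ _ _ : ℝ), Real.norm_of_nonneg (h_nonneg _), integral_mul_const,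
      integral_minDivMaxFactor_mul hw.1 hw.2, pow_one,
      Real.norm_of_nonneg (minDivMax_nonneg hw.1.le hw.2.le)]

variable [SFinite μ]

lemma integral_prod_inner [CompleteSpace F] (hf : Integrable f μ) :
    ∫ w, inner ℝ (f w.1) (f w.2) ∂μ.prod μ = ‖∫ x, f x ∂μ‖ ^ 2 := by
  rw [← real_inner_self_eq_norm_sq]
  exact integral_prod_bilin (innerSL ℝ) hf hf

lemma integral_prod_integral_inner_nonneg [CompleteSpace F] {Z : Type*} [MeasurableSpace Z]
    {ν : Measure Z} [SFinite ν] {f : Z → X → F} (hf : ∀ᵐ z ∂ν, Integrable (f z) μ)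
    (h_int : Integrable (fun w : (X × X) × Z => inner ℝ (f w.2 w.1.1) (f w.2 w.1.2))
      ((μ.prod μ).prod ν)) :
    0 ≤ ∫ w, ∫ z, inner ℝ (f z w.1) (f z w.2) ∂ν ∂μ.prod μ := by
  rw [integral_integral_swap h_int]
  refine integral_nonneg_of_ae ?_
  filter_upwards [hf] with z hz
  rw [integral_prod_inner hz]
  exact sq_nonneg _

lemma integral_minDivMax_mul_inner_nonneg [CompleteSpace F] (ha : Measurable a)
    (ha_pos : ∀ᵐ x ∂μ, 0 < a x) (hf : Integrable f μ) :
    0 ≤ ∫ w, minDivMax (a w.1) (a w.2) * inner ℝ (f w.1) (f w.2) ∂μ.prod μ := by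
  have h_slice : ∀ᵐ z ∂volume.restrict (Ioi (0 : ℝ)),
      Integrable (fun x => minDivMaxFactor (a x) z • f x) μ := by
    filter_upwards [ae_restrict_mem measurableSet_Ioi] with z hz
    refine hf.bdd_smul (√z)⁻¹ (by fun_prop : Measurable _).aestronglyMeasurable ?_
    filter_upwards [ha_pos] with x hx
    exact (Real.norm_of_nonneg (minDivMaxFactor_nonneg hx.le z)).trans_le (minDivMaxFactor_le hx hz)
  refine (integral_prod_integral_inner_nonneg h_slice
    (integrable_inner_minDivMaxFactor_smul ha ha_pos hf)).trans_eq (integral_congr_ae ?_)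
  filter_upwards [ae_prod_and_of_ae ha_pos] with w hw
  simp only [real_inner_smul_smul, integral_mul_const,
    integral_minDivMaxFactor_mul hw.1 hw.2]

lemma integral_minDivMax_pow_mul_inner_nonneg [CompleteSpace F] (ha : Measurable a)
    (ha_pos : ∀ᵐ x ∂μ, 0 < a x) (hf : Integrable f μ) (n : ℕ) :
    0 ≤ ∫ w, minDivMax (a w.1) (a w.2) ^ n * inner ℝ (f w.1) (f w.2) ∂μ.prod μ := by
  refine (integral_minDivMax_mul_inner_nonneg (ha.pow_const n)
    (ha_pos.mono fun x hx => pow_pos hx n) hf).trans_eq (integral_congr_ae ?_)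
  filter_upwards [ae_prod_and_of_ae ha_pos] with w hw
  rw [minDivMax_pow hw.1.le hw.2.le]

end PositiveSemidefinite

section EnergyInequality

lemma exists_hasSum_one_sub_rpow_neg {b : ℝ} (hb : 0 < b) :
    ∃ c : ℕ → ℝ, c 0 = 1 ∧ (∀ n, 0 ≤ c n) ∧
      ∀ x : ℝ, 0 ≤ x → x < 1 → HasSum (fun n => c n * x ^ n) ((1 - x) ^ (-b)) := by
  refine ⟨fun n => Ring.choose (b + n - 1) n, by simp, fun n => ?_, fun x hx₀ hx₁ => ?_⟩
  · have h_eval := Ring.factorial_nsmul_multichoose_eq_ascPochhammer b n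
    rw [Polynomial.ascPochhammer_smeval_eq_eval, nsmul_eq_mul] at h_eval
    have h_choose : Ring.choose (b + n - 1) n = Ring.multichoose (b + n - 1 - n + 1) n := rfl
    beta_reduce
    rw [h_choose, show b + n - 1 - n + 1 = b by ring]
    exact (pos_of_mul_pos_right (h_eval ▸ ascPochhammer_pos n b hb) (Nat.cast_nonneg _)).le
  · have h_sum := (Real.one_div_one_sub_rpow_hasFPowerSeriesOnBall_zero b).hasSum (y := x) (by
      simp [enorm_eq_nnnorm, ← NNReal.coe_lt_coe, abs_of_nonneg hx₀, hx₁])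
    rw [Real.rpow_neg (by linarith)]
    simpa [FormalMultilinearSeries.ofScalars, mul_comm] using h_sum

section Integral

variable {X F : Type*} [MeasurableSpace X] {μ : Measure X} [SFinite μ]
  [NormedAddCommGroup F] [InnerProductSpace ℝ F] [CompleteSpace F] {a : X → ℝ} {f : X → F}

lemma norm_integral_sq_le_integral_sum (ha : Measurable a) (ha_pos : ∀ᵐ x ∂μ, 0 < a x)
    (hf : Integrable f μ) {c : ℕ → ℝ} (hc₀ : c 0 = 1) (hc : ∀ n, 0 ≤ c n) {N : ℕ} (hN : 0 < N) :
    ‖∫ x, f x ∂μ‖ ^ 2 ≤ ∫ w, (∑ n ∈ Finset.range N, c n * minDivMax (a w.1) (a w.2) ^ n) *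
      inner ℝ (f w.1) (f w.2) ∂μ.prod μ := by
  set G : ℕ → ℝ := fun n =>
    ∫ w, minDivMax (a w.1) (a w.2) ^ n * inner ℝ (f w.1) (f w.2) ∂μ.prod μ with hG
  have h_sum : ∫ w, (∑ n ∈ Finset.range N, c n * minDivMax (a w.1) (a w.2) ^ n) *
      inner ℝ (f w.1) (f w.2) ∂μ.prod μ = ∑ n ∈ Finset.range N, c n * G n := by
    simp only [Finset.sum_mul, mul_assoc]
    rw [integral_finsetSum _ fun n _ =>
      (integrable_minDivMax_pow_mul_inner ha ha_pos hf n).const_mul (c n)]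
    simp only [integral_const_mul, hG]
  have h_zero : c 0 * G 0 = ‖∫ x, f x ∂μ‖ ^ 2 := by
    simp only [hG, hc₀, pow_zero, one_mul, integral_prod_inner hf]
  rw [h_sum, ← h_zero]
  exact Finset.single_le_sum (f := fun n => c n * G n)
    (fun n _ => mul_nonneg (hc n) (integral_minDivMax_pow_mul_inner_nonneg ha ha_pos hf n))
    (Finset.mem_range.2 hN)

lemma norm_integral_sq_le_integral_one_sub_minDivMax_rpow (ha : Measurable a)
    (ha_pos : ∀ᵐ x ∂μ, 0 < a x) (ha_ne : ∀ᵐ w ∂μ.prod μ, a w.1 ≠ a w.2) (hf : Integrable f μ)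
    {b : ℝ} (hb : 0 < b)
    (h_int : Integrable (fun w : X × X =>
      (1 - minDivMax (a w.1) (a w.2)) ^ (-b) * inner ℝ (f w.1) (f w.2)) (μ.prod μ)) :
    ‖∫ x, f x ∂μ‖ ^ 2 ≤
      ∫ w, (1 - minDivMax (a w.1) (a w.2)) ^ (-b) * inner ℝ (f w.1) (f w.2) ∂μ.prod μ := by
  obtain ⟨c, hc₀, hc, h_sum⟩ := exists_hasSum_one_sub_rpow_neg hb
  have h_sum_ae : ∀ᵐ w ∂μ.prod μ, 0 ≤ minDivMax (a w.1) (a w.2) ∧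
      HasSum (fun n => c n * minDivMax (a w.1) (a w.2) ^ n)
        ((1 - minDivMax (a w.1) (a w.2)) ^ (-b)) := by
    filter_upwards [ae_prod_and_of_ae ha_pos, ha_ne] with w hw h_ne
    have h_nonneg := minDivMax_nonneg hw.1.le hw.2.le
    exact ⟨h_nonneg, h_sum _ h_nonneg (minDivMax_lt_one hw.1 h_ne)⟩
  refine ge_of_tendsto (tendsto_integral_of_dominated_convergence _ (fun N => ?_) h_int.norm
    (fun N => ?_) (h_sum_ae.mono fun w hw => hw.2.tendsto_sum_nat.mul_const _)) ?_
  · exact (by fun_prop : Measurable _).aestronglyMeasurable.mul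
      (integrable_prod_inner hf).aestronglyMeasurable
  · filter_upwards [h_sum_ae] with w ⟨h_nonneg, hw⟩
    have h_terms (n : ℕ) : 0 ≤ c n * minDivMax (a w.1) (a w.2) ^ n :=
      mul_nonneg (hc n) (pow_nonneg h_nonneg n)
    rw [norm_mul, norm_mul]
    gcongr
    rw [Real.norm_of_nonneg (Finset.sum_nonneg fun n _ => h_terms n),
      Real.norm_of_nonneg (hw.nonneg h_terms)]
    exact sum_le_hasSum _ (fun n _ => h_terms n) hw
  · filter_upwards [Filter.eventually_gt_atTop 0] with N hN
    exact norm_integral_sq_le_integral_sum ha ha_pos hf hc₀ hc hN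

end Integral

lemma one_sub_minDivMax_rpow_mul_rlKernel (α : ℝ) {p q : ℝ} (hp : 0 < p) (hq : 0 < q)
    (hne : p ≠ q) :
    (1 - minDivMax p q) ^ (-(1 - α)) * (rlKernel α p * rlKernel α q) =
      rlKernel α q * rlKernel α (p - q) + rlKernel α p * rlKernel α (q - p) := by
  wlog h : q < p generalizing p q
  · rw [minDivMax_comm, mul_comm (rlKernel α p), this hq hp hne.symm (hne.lt_or_gt.resolve_right h),
      add_comm]
  have h_sub : 0 < p - q := sub_pos.2 h
  rw [rlKernel_of_nonpos (by linarith : q - p ≤ 0), rlKernel_of_pos hp, rlKernel_of_pos hq,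
    rlKernel_of_pos h_sub, minDivMax_comm, minDivMax_of_le h.le, one_sub_div hp.ne', neg_sub,
    Real.div_rpow h_sub.le hp.le]
  have := (Real.rpow_pos_of_pos hp (α - 1)).ne'
  field_simp
  ring

lemma ae_prod_fst_ne_snd (μ : Measure ℝ) [SFinite μ] [NullSingletonClass μ] :
    ∀ᵐ z ∂μ.prod μ, z.1 ≠ z.2 := by
  have h_diag : (μ.prod μ) (diagonal ℝ) = 0 := by
    rw [Measure.measure_prod_null measurableSet_diagonal]
    refine .of_forall fun p => ?_
    have : Prod.mk p ⁻¹' diagonal ℝ = {p} := by ext q; simp [eq_comm]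
    simp [this]
  exact measure_mono_null (fun z hz => by simpa using hz) h_diag

variable {F : Type*} [NormedAddCommGroup F] [InnerProductSpace ℝ F] {α t T : ℝ}

lemma memLp_top_inner {φ ψ : ℝ → F} (hφ : MemLp φ ∞ (segMeasure T))
    (hψ : MemLp ψ ∞ (segMeasure T)) : MemLp (fun τ => inner ℝ (φ τ) (ψ τ)) ∞ (segMeasure T) :=
  (innerSL ℝ).memLp_of_bilin ∞ hφ hψ

lemma integrable_prod_rlKernel_mul_inner (hα : 0 < α) {ψ : ℝ → F}
    (hψ : MemLp ψ ∞ (segMeasure T)) (t : ℝ) :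
    Integrable (fun z : ℝ × ℝ =>
      rlKernel α (t - z.1) * rlKernel α (z.1 - z.2) * inner ℝ (ψ z.1) (ψ z.2))
      ((segMeasure T).prod (segMeasure T)) :=
  (integrable_prod_mul_rlKernel hα (integrable_rlKernel_sub_left hα t T)).mul_of_top_left
    ((innerSL ℝ).memLp_of_bilin ∞ (hψ.comp_fst _) (hψ.comp_snd _))

variable [CompleteSpace F]

lemma inner_fracIntegral (hα : 0 < α) {φ : ℝ → F} (hφ : MemLp φ ∞ (segMeasure T)) (ht : t ≤ T)
    (c : F) : inner ℝ c (fracIntegral α φ t) = fracIntegral α (fun τ => inner ℝ c (φ τ)) t := by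
  simp only [fracIntegral_eq_integral_segMeasure ht, smul_eq_mul, ← real_inner_smul_right]
  exact (integral_inner (integrable_rlKernel_sub_left_smul hα hφ t) c).symm

lemma integral_prod_rlKernel_mul_inner (hα : 0 < α) {ψ : ℝ → F}
    (hψ : MemLp ψ ∞ (segMeasure t)) :
    ∫ z, rlKernel α (t - z.1) * rlKernel α (z.1 - z.2) * inner ℝ (ψ z.1) (ψ z.2)
      ∂(segMeasure t).prod (segMeasure t) =
      fracIntegral α (fun τ => inner ℝ (ψ τ) (fracIntegral α ψ τ)) t := by
  rw [integral_prod _ (integrable_prod_rlKernel_mul_inner hα hψ t),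
    fracIntegral_eq_integral_segMeasure le_rfl]
  refine integral_congr_ae ?_
  filter_upwards [ae_segMeasure_mem_Icc t] with τ hτ
  rw [inner_fracIntegral hα hψ hτ.2]
  simp only [mul_assoc, integral_const_mul, smul_eq_mul, fracIntegral_eq_integral_segMeasure hτ.2]

lemma norm_fracIntegral_sq_le (hα₀ : 0 < α) (hα₁ : α < 1) {ψ : ℝ → F}
    (hψ : MemLp ψ ∞ (segMeasure t)) :
    ‖fracIntegral α ψ t‖ ^ 2 ≤
      2 * fracIntegral α (fun τ => inner ℝ (ψ τ) (fracIntegral α ψ τ)) t := by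
  set μ := segMeasure t
  set H : ℝ × ℝ → ℝ := fun z =>
    rlKernel α (t - z.1) * rlKernel α (z.1 - z.2) * inner ℝ (ψ z.1) (ψ z.2)
  have h_pos : ∀ᵐ τ ∂μ, 0 < t - τ := by
    filter_upwards [ae_segMeasure_mem_Icc t, Measure.ae_ne μ t] with τ hτ h_ne
    exact sub_pos.2 (lt_of_le_of_ne hτ.2 h_ne)
  have h_ne : ∀ᵐ z ∂μ.prod μ, t - z.1 ≠ t - z.2 :=
    (ae_prod_fst_ne_snd μ).mono fun z hz h => hz (by linarith)
  have hH : Integrable H (μ.prod μ) := integrable_prod_rlKernel_mul_inner hα₀ hψ t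
  have h_symm : (fun z : ℝ × ℝ => (1 - minDivMax (t - z.1) (t - z.2)) ^ (-(1 - α)) *
      inner ℝ (rlKernel α (t - z.1) • ψ z.1) (rlKernel α (t - z.2) • ψ z.2))
      =ᵐ[μ.prod μ] fun z => H z + H z.swap := by
    filter_upwards [ae_prod_and_of_ae h_pos, h_ne] with z hz h_ne
    rw [real_inner_smul_smul, ← mul_assoc, one_sub_minDivMax_rpow_mul_rlKernel α hz.1 hz.2 h_ne,
      sub_sub_sub_cancel_left, sub_sub_sub_cancel_left, add_comm, add_mul]
    simp only [H, Prod.fst_swap, Prod.snd_swap, real_inner_comm]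
  have h_ineq := norm_integral_sq_le_integral_one_sub_minDivMax_rpow
    (by fun_prop : Measurable fun τ => t - τ) h_pos h_ne
    (integrable_rlKernel_sub_left_smul hα₀ hψ t)
    (sub_pos.2 hα₁) ((hH.add hH.swap).congr h_symm.symm)
  calc ‖fracIntegral α ψ t‖ ^ 2
      ≤ ∫ z, (H z + H z.swap) ∂μ.prod μ := by
        rw [fracIntegral_eq_integral_segMeasure le_rfl, ← integral_congr_ae h_symm]
        exact h_ineq
    _ = 2 * ∫ z, H z ∂μ.prod μ := by
        rw [integral_add hH (by exact hH.swap), integral_prod_swap, two_mul]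
    _ = _ := by rw [integral_prod_rlKernel_mul_inner hα₀ hψ]

lemma norm_add_fracIntegral_sq_le (hα₀ : 0 < α) (hα₁ : α < 1) {ψ : ℝ → F}
    (hψ : MemLp ψ ∞ (segMeasure T)) (s₀ : F) (ht : t ≤ T) :
    ‖s₀ + fracIntegral α ψ t‖ ^ 2 ≤
      ‖s₀‖ ^ 2 + 2 * fracIntegral α (fun τ => inner ℝ (ψ τ) (s₀ + fracIntegral α ψ τ)) t := by
  have hψt : MemLp ψ ∞ (segMeasure t) :=
    hψ.mono_measure (Measure.restrict_mono (Icc_subset_Icc_right ht) le_rfl)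
  have h_split : fracIntegral α (fun τ => inner ℝ (ψ τ) (s₀ + fracIntegral α ψ τ)) t =
      inner ℝ s₀ (fracIntegral α ψ t) +
        fracIntegral α (fun τ => inner ℝ (ψ τ) (fracIntegral α ψ τ)) t := by
    rw [inner_fracIntegral hα₀ hψt le_rfl, ← fracIntegral_add hα₀
      (memLp_top_inner (memLp_top_const s₀) hψt) (memLp_top_inner hψt
        (memLp_top_of_continuousOn (continuousOn_fracIntegral hα₀ hα₁.le hψt))) le_rfl]
    simp only [inner_add_right, real_inner_comm s₀]
  rw [h_split, norm_add_sq_real]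
  linarith [norm_fracIntegral_sq_le hα₀ hα₁ hψt]

end EnergyInequality

section Caputo

variable {k : ℕ} {α T : ℝ} {x₀ : E k} {x φ : ℝ → E k}

lemma hasCaputoDerivAt_iff_hasDerivAt_rlIntegral {d : E k} {t : ℝ} :
    HasCaputoDerivAt α x d t ↔
      HasDerivAt (fun r => rlIntegral (1 - α) (fun τ => x τ - x 0) r) d t := by
  simp only [HasCaputoDerivAt, rlIntegral, sub_sub_cancel]

lemma rlIntegral_one_sub_eq_integral (hα₀ : 0 < α) (hα₁ : α < 1) (hφ : MemLp φ ∞ (segMeasure T))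
    (hx : ∀ t ∈ Icc 0 T, x t = x₀ + fracIntegral α φ t) {t : ℝ} (ht : t ∈ Icc 0 T) :
    rlIntegral (1 - α) (fun τ => x τ - x 0) t = ∫ τ in (0 : ℝ)..t, φ τ := by
  have hx_zero : x 0 = x₀ := by
    simp [hx 0 ⟨le_rfl, ht.1.trans ht.2⟩, fracIntegral_eq_setIntegral_Ioo]
  have h_sub : (fun τ => x τ - x 0) =ᵐ[segMeasure t] fracIntegral α φ := by
    filter_upwards [ae_segMeasure_mem_Icc t] with τ hτ
    rw [hx_zero, hx τ ⟨hτ.1, hτ.2.trans ht.2⟩, add_sub_cancel_left]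
  rw [rlIntegral_eq_fracIntegral _ _ ht.1, fracIntegral_congr_ae le_rfl h_sub,
    fracIntegral_fracIntegral hα₀ (sub_pos.2 hα₁) hφ ht.2, add_sub_cancel, fracIntegral_one φ ht.1]

lemma hasCaputoDerivAt_ae_of_eq_add_fracIntegral (hα₀ : 0 < α) (hα₁ : α < 1)
    (hφ : MemLp φ ∞ (segMeasure T)) (hx : ∀ t ∈ Icc 0 T, x t = x₀ + fracIntegral α φ t) :
    ∀ᵐ t ∂segMeasure T, HasCaputoDerivAt α x (φ t) t := by
  rcases lt_or_ge T 0 with hT | hT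
  · simp [segMeasure, Icc_eq_empty_of_lt hT]
  have h_int : IntervalIntegrable φ volume 0 T :=
    (intervalIntegrable_iff_integrableOn_Icc_of_le hT).2 (hφ.integrable le_top)
  filter_upwards [ae_restrict_of_ae h_int.ae_hasDerivAt_integral, ae_segMeasure_mem_Icc T,
    Measure.ae_ne _ 0, Measure.ae_ne _ T] with t h_deriv ht h_ne_zero h_ne_T
  rw [uIcc_of_le hT] at h_deriv
  have h_nhds : Icc 0 T ∈ nhds t :=
    Icc_mem_nhds (lt_of_le_of_ne ht.1 h_ne_zero.symm) (lt_of_le_of_ne ht.2 h_ne_T)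
  rw [hasCaputoDerivAt_iff_hasDerivAt_rlIntegral]
  refine (h_deriv ht 0 ⟨le_rfl, hT⟩).congr_of_eventuallyEq ?_
  filter_upwards [h_nhds] with r hr using rlIntegral_one_sub_eq_integral hα₀ hα₁ hφ hx hr

end Caputo

section CauchySolution

variable {n : ℕ} {α T : ℝ} {f f' : ℝ → E n → E n} {x₀ y₀ : E n} {x y : ℝ → E n}

lemma IsCauchySolution.exists_density (h : IsCauchySolution α T f x₀ x) (hα₀ : 0 < α)
    (hα₁ : α < 1) :
    ∃ φ, MemLp φ ∞ (segMeasure T) ∧ φ =ᵐ[segMeasure T] (fun τ => f τ (x τ)) ∧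
      ∀ t ∈ Icc 0 T, x t = x₀ + fracIntegral α φ t := by
  obtain ⟨⟨φ, hφ, hx⟩, h_deriv⟩ := h
  have hx' : ∀ t ∈ Icc 0 T, x t = x₀ + fracIntegral α φ t := fun t ht => by
    rw [hx t ht, rlIntegral_eq_fracIntegral α φ ht.1]
  refine ⟨φ, hφ, ?_, hx'⟩
  filter_upwards [h_deriv, hasCaputoDerivAt_ae_of_eq_add_fracIntegral hα₀ hα₁ hφ hx']
    with t ht ht' using ht'.unique ht

lemma IsCauchySolution.memLp_rhs (h : IsCauchySolution α T f x₀ x) (hα₀ : 0 < α) (hα₁ : α < 1) :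
    MemLp (fun τ => f τ (x τ)) ∞ (segMeasure T) := by
  obtain ⟨φ, hφ, h_ae, -⟩ := h.exists_density hα₀ hα₁
  exact (memLp_congr_ae h_ae).1 hφ

lemma IsCauchySolution.eq_add_fracIntegral (h : IsCauchySolution α T f x₀ x) (hα₀ : 0 < α)
    (hα₁ : α < 1) {t : ℝ} (ht : t ∈ Icc 0 T) :
    x t = x₀ + fracIntegral α (fun τ => f τ (x τ)) t := by
  obtain ⟨φ, -, h_ae, hx⟩ := h.exists_density hα₀ hα₁
  rw [hx t ht, fracIntegral_congr_ae ht.2 h_ae]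

lemma IsCauchySolution.continuousOn (h : IsCauchySolution α T f x₀ x) (hα₀ : 0 < α)
    (hα₁ : α < 1) : ContinuousOn x (Icc 0 T) :=
  (continuousOn_const.add (continuousOn_fracIntegral hα₀ hα₁.le (h.memLp_rhs hα₀ hα₁))).congr
    fun _ => h.eq_add_fracIntegral hα₀ hα₁

lemma IsCauchySolution.norm_sub_le (h : IsCauchySolution α T f x₀ x) (hα₀ : 0 < α) (hα₁ : α < 1)
    {C : ℝ} (hC₀ : 0 ≤ C) (hC : ∀ᵐ τ ∂segMeasure T, ‖f τ (x τ)‖ ≤ C) {r t : ℝ} (hr : 0 ≤ r)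
    (hrt : r ≤ t) (ht : t ≤ T) : ‖x t - x r‖ ≤ 2 * C * rlKernel (α + 1) (t - r) := by
  rw [h.eq_add_fracIntegral hα₀ hα₁ ⟨hr.trans hrt, ht⟩,
    h.eq_add_fracIntegral hα₀ hα₁ ⟨hr, hrt.trans ht⟩, add_sub_add_left_eq_sub]
  exact norm_fracIntegral_sub_le hα₀ hα₁.le (h.memLp_rhs hα₀ hα₁) hC₀ hC hr hrt ht

lemma IsCauchySolution.one_add_norm_le (h : IsCauchySolution α T f x₀ x) (hα₀ : 0 < α)
    (hα₁ : α < 1) {c : ℝ} (hc : 0 < c) (hf : ∀ᵐ τ ∂segMeasure T, ‖f τ (x τ)‖ ≤ (1 + ‖x τ‖) * c)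
    {t : ℝ} (ht : t ∈ Icc 0 T) :
    1 + ‖x t‖ ≤ 2 * (1 + ‖x₀‖) * Real.exp ((2 * c) ^ (1 / α) * t) := by
  have hw : ContinuousOn (fun t => 1 + ‖x t‖) (Icc 0 T) :=
    continuousOn_const.add (h.continuousOn hα₀ hα₁).norm
  refine le_mul_exp_of_le_add_fracIntegral hα₀ (by positivity) hc hw (fun t ht => ?_) ht
  have h_rhs : ‖fracIntegral α (fun τ => f τ (x τ)) t‖ ≤
      c * fracIntegral α (fun τ => 1 + ‖x τ‖) t := by
    rw [← fracIntegral_const_mul]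
    refine (norm_fracIntegral_le hα₀ _ t).trans (fracIntegral_mono_ae hα₀
      (h.memLp_rhs hα₀ hα₁).norm ((memLp_top_of_continuousOn hw).const_mul c) ?_ ht.2)
    filter_upwards [hf] with τ hτ using hτ.trans_eq (mul_comm _ _)
  calc 1 + ‖x t‖ ≤ 1 + (‖x₀‖ + ‖fracIntegral α (fun τ => f τ (x τ)) t‖) := by
        rw [h.eq_add_fracIntegral hα₀ hα₁ ht]
        gcongr
        exact norm_add_le _ _
    _ ≤ 1 + ‖x₀‖ + c * fracIntegral α (fun τ => 1 + ‖x τ‖) t := by linarith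

lemma IsCauchySolution.norm_sub_sq_le_add_fracIntegral (hx : IsCauchySolution α T f x₀ x)
    (hy : IsCauchySolution α T f' y₀ y) (hα₀ : 0 < α) (hα₁ : α < 1) {t : ℝ} (ht : t ∈ Icc 0 T) :
    ‖x t - y t‖ ^ 2 ≤ ‖x₀ - y₀‖ ^ 2 + 2 * fracIntegral α
      (fun τ => inner ℝ (f τ (x τ) - f' τ (y τ)) (x τ - y τ)) t := by
  have hx_rhs := hx.memLp_rhs hα₀ hα₁
  have hy_rhs := hy.memLp_rhs hα₀ hα₁
  have h_sub {r : ℝ} (hr : r ∈ Icc 0 T) :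
      x r - y r = x₀ - y₀ + fracIntegral α (fun τ => f τ (x τ) - f' τ (y τ)) r := by
    rw [hx.eq_add_fracIntegral hα₀ hα₁ hr, hy.eq_add_fracIntegral hα₀ hα₁ hr,
      fracIntegral_sub hα₀ hx_rhs hy_rhs hr.2]
    abel
  rw [h_sub ht]
  refine (norm_add_fracIntegral_sq_le hα₀ hα₁ (hx_rhs.sub hy_rhs) _ ht.2).trans_eq ?_
  congr 2
  refine fracIntegral_congr_ae ht.2 ?_
  filter_upwards [ae_segMeasure_mem_Icc T] with τ hτ
  rw [h_sub hτ]
  rfl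

lemma IsCauchySolution.norm_sub_sq_le (hx : IsCauchySolution α T f x₀ x)
    (hy : IsCauchySolution α T f' y₀ y) (hα₀ : 0 < α) (hα₁ : α < 1) {L η : ℝ} (hL : 0 < L)
    (hη : 0 ≤ η) (h : ∀ᵐ τ ∂segMeasure T,
      inner ℝ (f τ (x τ) - f' τ (y τ)) (x τ - y τ) ≤ L * ‖x τ - y τ‖ ^ 2 + η)
    {t : ℝ} (ht : t ∈ Icc 0 T) :
    ‖x t - y t‖ ^ 2 ≤ 2 * (‖x₀ - y₀‖ ^ 2 + 2 * η * rlKernel (α + 1) T) *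
      Real.exp ((4 * L) ^ (1 / α) * T) := by
  have h_kernel := rlKernel_nonneg (α := α + 1) (by positivity) T
  have h_cont : ContinuousOn (fun τ => x τ - y τ) (Icc 0 T) :=
    (hx.continuousOn hα₀ hα₁).sub (hy.continuousOn hα₀ hα₁)
  have hw : ContinuousOn (fun τ => ‖x τ - y τ‖ ^ 2) (Icc 0 T) := h_cont.norm.pow 2
  have hLw := (memLp_top_of_continuousOn hw).const_mul L
  have h_inner := memLp_top_inner ((hx.memLp_rhs hα₀ hα₁).sub (hy.memLp_rhs hα₀ hα₁))
    (memLp_top_of_continuousOn h_cont)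
  have h_gronwall : ∀ r ∈ Icc 0 T, ‖x r - y r‖ ^ 2 ≤ ‖x₀ - y₀‖ ^ 2 + 2 * η * rlKernel (α + 1) T +
      2 * L * fracIntegral α (fun τ => ‖x τ - y τ‖ ^ 2) r := fun r hr => by
    have h_mono : fracIntegral α (fun τ => inner ℝ (f τ (x τ) - f' τ (y τ)) (x τ - y τ)) r ≤
        fracIntegral α (fun τ => L * ‖x τ - y τ‖ ^ 2 + η) r :=
      fracIntegral_mono_ae hα₀ h_inner (hLw.add (memLp_top_const η)) h hr.2
    have h_split := fracIntegral_add hα₀ hLw (memLp_top_const η) hr.2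
    rw [fracIntegral_const_mul, fracIntegral_const hα₀, smul_eq_mul] at h_split
    have h_const := mul_le_mul_of_nonneg_right (monotone_rlKernel_add_one hα₀ hr.2) hη
    linarith [hx.norm_sub_sq_le_add_fracIntegral hy hα₀ hα₁ hr, h_mono.trans_eq h_split]
  refine (le_mul_exp_of_le_add_fracIntegral hα₀ (by positivity) (by positivity) hw h_gronwall
    ht).trans ?_
  rw [← mul_assoc, show (2 : ℝ) * 2 = 4 by norm_num]
  gcongr
  exact ht.2

end CauchySolution

section Control

variable {n nu nv : ℕ} {α T : ℝ} {P : Set (E nu)} {Q : Set (E nv)}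
  {g : ℝ → E n → E nu → E nv → E n}

/-- The bundle of all motions under admissible controls whose initial values lie in the closed ball
of radius `R` about the origin. -/
def motionsFromBall (α T : ℝ) (P : Set (E nu)) (Q : Set (E nv))
    (g : ℝ → E n → E nu → E nv → E n) (R : ℝ) : Set (ℝ → E n) :=
  {x | ∃ x₀ ∈ Metric.closedBall (0 : E n) R, ∃ u v,
    IsAdmissible T P u ∧ IsAdmissible T Q v ∧ IsMotion α T g x₀ u v x}

lemma ae_segMeasure_mem_Ico (T : ℝ) : ∀ᵐ t ∂segMeasure T, t ∈ Ico 0 T := by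
  filter_upwards [ae_segMeasure_mem_Icc T, Measure.ae_ne _ T] with t ht h_ne
    using ⟨ht.1, lt_of_le_of_ne ht.2 h_ne⟩

lemma ae_norm_le_of_isAdmissible {c : ℝ}
    (hc : ∀ t ∈ Icc 0 T, ∀ x : E n, ∀ u ∈ P, ∀ v ∈ Q, ‖g t x u v‖ ≤ (1 + ‖x‖) * c)
    {u : ℝ → E nu} {v : ℝ → E nv} (hu : IsAdmissible T P u) (hv : IsAdmissible T Q v)
    (x : ℝ → E n) : ∀ᵐ t ∂segMeasure T, ‖g t (x t) (u t) (v t)‖ ≤ (1 + ‖x t‖) * c := by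
  filter_upwards [ae_segMeasure_mem_Ico T] with t ht
    using hc t (Ico_subset_Icc_self ht) _ _ (hu.2 t ht) _ (hv.2 t ht)

lemma IsConflictSystem.exists_norm_le (hg : IsConflictSystem T P Q g) (hα₀ : 0 < α)
    (hα₁ : α < 1) {R : ℝ} (hR : 0 ≤ R) :
    ∃ M > 0, ∀ x ∈ motionsFromBall α T P Q g R, ∀ t ∈ Icc 0 T, ‖x t‖ ≤ M := by
  obtain ⟨c, hc₀, hc⟩ := hg.linear_growth
  refine ⟨2 * (1 + R) * Real.exp ((2 * c) ^ (1 / α) * T), by positivity, ?_⟩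
  rintro x ⟨x₀, hx₀, u, v, hu, hv, hx⟩ t ht
  rw [mem_closedBall_zero_iff] at hx₀
  calc ‖x t‖ ≤ 1 + ‖x t‖ := by linarith
    _ ≤ 2 * (1 + ‖x₀‖) * Real.exp ((2 * c) ^ (1 / α) * t) :=
      IsCauchySolution.one_add_norm_le hx hα₀ hα₁ hc₀ (ae_norm_le_of_isAdmissible hc hu hv x) ht
    _ ≤ 2 * (1 + R) * Real.exp ((2 * c) ^ (1 / α) * T) := by
      gcongr
      exact ht.2

lemma IsConflictSystem.exists_norm_sub_le (hg : IsConflictSystem T P Q g) (hα₀ : 0 < α)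
    (hα₁ : α < 1) {R : ℝ} (hR : 0 ≤ R) {ρ : ℝ} (hρ : 0 < ρ) :
    ∃ δ > 0, ∀ x ∈ motionsFromBall α T P Q g R, ∀ r t, 0 ≤ r → r ≤ t → t ≤ T → t - r ≤ δ →
      ‖x t - x r‖ ≤ ρ := by
  obtain ⟨c, hc₀, hc⟩ := hg.linear_growth
  obtain ⟨M, hM₀, hM⟩ := hg.exists_norm_le hα₀ hα₁ hR
  have h_lim : Filter.Tendsto (fun d => 2 * ((1 + M) * c) * rlKernel (α + 1) d) (nhds 0)
      (nhds 0) := by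
    have h_cont := (continuous_rlKernel_add_one hα₀).const_mul (2 * ((1 + M) * c))
    simpa [rlKernel_of_nonpos] using h_cont.tendsto 0
  obtain ⟨δ, hδ₀, hδ⟩ := Metric.eventually_nhds_iff.1 (h_lim.eventually_le_const hρ)
  refine ⟨δ / 2, by positivity, ?_⟩
  rintro x hx r t hr hrt ht hrtδ
  have h_bound := hM x hx
  obtain ⟨x₀, -, u, v, hu, hv, hx⟩ := hx
  have h_rhs : ∀ᵐ τ ∂segMeasure T, ‖g τ (x τ) (u τ) (v τ)‖ ≤ (1 + M) * c := by
    filter_upwards [ae_norm_le_of_isAdmissible hc hu hv x, ae_segMeasure_mem_Icc T] with τ h hτ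
    refine h.trans ?_
    gcongr
    exact h_bound τ hτ
  refine (IsCauchySolution.norm_sub_le hx hα₀ hα₁ (by positivity) h_rhs hr hrt ht).trans (hδ ?_)
  rw [Real.dist_0_eq_abs, abs_of_nonneg (sub_nonneg.2 hrt)]
  linarith

lemma IsConflictSystem.exists_abs_inner_sub_le (hg : IsConflictSystem T P Q g) (M : ℝ) {η : ℝ}
    (hη : 0 < η) :
    ∃ ρ > 0, ∀ t ∈ Icc 0 T, ∀ r ∈ Icc 0 T, |t - r| ≤ ρ →
      ∀ x ∈ Metric.closedBall (0 : E n) M, ∀ y ∈ Metric.closedBall (0 : E n) M, ‖x - y‖ ≤ ρ →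
      ∀ s ∈ Metric.closedBall (0 : E n) M, ∀ s' ∈ Metric.closedBall (0 : E n) M, ‖s - s'‖ ≤ ρ →
      ∀ u ∈ P, ∀ v ∈ Q, |inner ℝ s (g t x u v) - inner ℝ s' (g r y u v)| ≤ η := by
  let ball := Metric.closedBall (0 : E n) M
  have h_compact : IsCompact (ball ×ˢ Icc 0 T ×ˢ ball ×ˢ P ×ˢ Q) :=
    (isCompact_closedBall _ _).prod <| isCompact_Icc.prod <| (isCompact_closedBall _ _).prod <|
      hg.compact_P.prod hg.compact_Q
  have h_cont : ContinuousOn (fun z : E n × ℝ × E n × E nu × E nv =>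
      inner ℝ z.1 (g z.2.1 z.2.2.1 z.2.2.2.1 z.2.2.2.2)) (ball ×ˢ Icc 0 T ×ˢ ball ×ˢ P ×ˢ Q) :=
    continuousOn_fst.inner (𝕜 := ℝ) <| hg.continuousOn.comp continuousOn_snd
      fun _ hz => ⟨hz.2.1, mem_univ _, hz.2.2.2⟩
  obtain ⟨ρ, hρ₀, hρ⟩ :=
    Metric.uniformContinuousOn_iff.1 (h_compact.uniformContinuousOn_of_continuous h_cont) η hη
  refine ⟨ρ / 2, by positivity, fun t ht r hr htr x hx y hy hxy s hs s' hs' hss u hu v hv => ?_⟩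
  refine (hρ (s, t, x, u, v) ⟨hs, ht, hx, hu, hv⟩ (s', r, y, u, v) ⟨hs', hr, hy, hu, hv⟩ ?_).le
  have h_dist : dist (s, t, x, u, v) (s', r, y, u, v) ≤ ρ / 2 := by
    simp only [Prod.dist_eq, dist_self, dist_eq_norm s, dist_eq_norm x, Real.dist_eq, max_le_iff]
    exact ⟨hss, htr, hxy, by positivity⟩
  exact h_dist.trans_lt (half_lt_self hρ₀)

lemma IsConflictSystem.inner_le_inner_of_mem_argMin_argMax (hg : IsConflictSystem T P Q g)
    {t : ℝ} (ht : t ∈ Icc 0 T) (x s : E n) {u u' : E nu} {v v' : E nv}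
    (hu : u ∈ argMin P (maxOverQ Q g t x s)) (hv' : v' ∈ argMax Q (minOverP P g t x s))
    (hu' : u' ∈ P) (hv : v ∈ Q) : inner ℝ s (g t x u v) ≤ inner ℝ s (g t x u' v') := by
  obtain ⟨c, -, hc⟩ := hg.linear_growth
  have h_abs : ∀ u ∈ P, ∀ v ∈ Q, |inner ℝ s (g t x u v)| ≤ ‖s‖ * ((1 + ‖x‖) * c) :=
    fun u hu v hv => (abs_real_inner_le_norm _ _).trans
      (mul_le_mul_of_nonneg_left (hc t ht x u hu v hv) (norm_nonneg _))
  have : Nonempty P := ⟨⟨u', hu'⟩⟩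
  have : Nonempty Q := ⟨⟨v, hv⟩⟩
  have h_above : BddAbove (range fun w : Q => (inner ℝ s (g t x u w) : ℝ)) :=
    ⟨_, forall_mem_range.2 fun w => (abs_le.1 (h_abs u hu.1 w w.2)).2⟩
  have h_below : BddBelow (range fun w : P => (inner ℝ s (g t x w v') : ℝ)) :=
    ⟨_, forall_mem_range.2 fun w => (abs_le.1 (h_abs w w.2 v' hv'.1)).1⟩
  calc inner ℝ s (g t x u v) ≤ maxOverQ Q g t x s u := le_ciSup h_above ⟨v, hv⟩
    _ ≤ ⨅ w : P, maxOverQ Q g t x s w := le_ciInf fun w => hu.2 w.2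
    _ = ⨆ w : Q, minOverP P g t x s w := hg.saddle_point t ht x s
    _ ≤ minOverP P g t x s v' := ciSup_le fun w => hv'.2 w.2
    _ ≤ inner ℝ s (g t x u' v') := ciInf_le h_below ⟨u', hu'⟩

lemma IsConflictSystem.inner_sub_le_of_mem_argMin_argMax (hg : IsConflictSystem T P Q g)
    {t r L η : ℝ} (hr : r ∈ Icc 0 T) {x y x' s' : E n} {u u' : E nu} {v v' : E nv}
    (hu : u ∈ argMin P (maxOverQ Q g r x' s')) (hv' : v' ∈ argMax Q (minOverP P g r x' s'))
    (hu' : u' ∈ P) (hv : v ∈ Q) (h_lip : ‖g t x u' v' - g t y u' v'‖ ≤ L * ‖x - y‖)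
    (h_close : ∀ a ∈ P, ∀ b ∈ Q,
      |inner ℝ (x - y) (g t x a b) - inner ℝ s' (g r x' a b)| ≤ η) :
    inner ℝ (g t x u v - g t y u' v') (x - y) ≤ L * ‖x - y‖ ^ 2 + 2 * η := by
  have h_system := (abs_le.1 (h_close u hu.1 v hv)).2
  have h_guide := (abs_le.1 (h_close u' hu' v' hv'.1)).1
  have h_saddle := hg.inner_le_inner_of_mem_argMin_argMax hr x' s' hu hv' hu' hv
  have h_inner : inner ℝ (x - y) (g t x u' v' - g t y u' v') ≤ L * ‖x - y‖ ^ 2 :=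
    calc inner ℝ (x - y) (g t x u' v' - g t y u' v')
      _ ≤ ‖x - y‖ * ‖g t x u' v' - g t y u' v'‖ := real_inner_le_norm _ _
      _ ≤ ‖x - y‖ * (L * ‖x - y‖) := by gcongr
      _ = L * ‖x - y‖ ^ 2 := by ring
  rw [inner_sub_right] at h_inner
  rw [real_inner_comm, inner_sub_right]
  linarith

lemma TimePartition.node_mem_Icc (Δ : TimePartition T) (i : Fin (Δ.k + 1)) :
    Δ.node i ∈ Icc 0 T :=
  ⟨Δ.node_zero ▸ Δ.strictMono.monotone (Fin.zero_le i),
    (Δ.strictMono.monotone (Fin.le_last i)).trans_eq Δ.node_last⟩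

lemma TimePartition.exists_mem_Ico (Δ : TimePartition T) {t : ℝ} (ht : t ∈ Ico 0 T) :
    ∃ j : Fin Δ.k, t ∈ Ico (Δ.node j.castSucc) (Δ.node j.succ) := by
  suffices h : ∀ i, t < Δ.node i → ∃ j : Fin Δ.k, t ∈ Ico (Δ.node j.castSucc) (Δ.node j.succ) from
    h (Fin.last _) (ht.2.trans_eq Δ.node_last.symm)
  intro i
  induction i using Fin.induction with
  | zero => exact fun h => absurd ht.1 (Δ.node_zero ▸ h).not_ge
  | succ j ih =>
    intro h
    rcases lt_or_ge t (Δ.node j.castSucc) with h_lt | h_ge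
    exacts [ih h_lt, ⟨j, h_ge, h⟩]

lemma TimePartition.node_sub_le_diam (Δ : TimePartition T) (j : Fin Δ.k) :
    Δ.node j.succ - Δ.node j.castSucc ≤ Δ.diam :=
  le_ciSup (f := fun j : Fin Δ.k => Δ.node j.succ - Δ.node j.castSucc)
    (finite_range _).bddAbove j

lemma IsConflictSystem.exists_inner_sub_le_of_isMutualAiming (hg : IsConflictSystem T P Q g)
    (hα₀ : 0 < α) (hα₁ : α < 1) {R : ℝ} (hR : 0 ≤ R) :
    ∃ L > 0, ∀ η > 0, ∃ δ > 0, ∀ x ∈ motionsFromBall α T P Q g R,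
      ∀ y ∈ motionsFromBall α T P Q g R, ∀ Δ : TimePartition T, Δ.diam ≤ δ →
      ∀ u u' v v', IsAdmissible T P u' → IsAdmissible T Q v → IsMutualAiming P Q g Δ x y u v' →
      ∀ t ∈ Ico 0 T, inner ℝ (g t (x t) (u t) (v t) - g t (y t) (u' t) (v' t)) (x t - y t) ≤
        L * ‖x t - y t‖ ^ 2 + η := by
  obtain ⟨M, hM₀, hM⟩ := hg.exists_norm_le hα₀ hα₁ hR
  have h_ball {x} (hx : x ∈ motionsFromBall α T P Q g R) {t} (ht : t ∈ Icc 0 T) :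
      x t ∈ Metric.closedBall 0 M := mem_closedBall_zero_iff.2 (hM x hx t ht)
  obtain ⟨L, hL₀, hL⟩ := hg.locally_lipschitz M hM₀.le
  refine ⟨L, hL₀, fun η hη => ?_⟩
  obtain ⟨ρ, hρ₀, hρ⟩ := hg.exists_abs_inner_sub_le (2 * M) (half_pos hη)
  obtain ⟨δ, hδ₀, hδ⟩ := hg.exists_norm_sub_le hα₀ hα₁ hR (half_pos hρ₀)
  refine ⟨min δ ρ, by positivity, fun x hx y hy Δ hΔ u u' v v' hu' hv h_aim t ht => ?_⟩
  obtain ⟨j, hj⟩ := Δ.exists_mem_Ico ht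
  obtain ⟨⟨uj, huj, hu_eq⟩, vj, hvj, hv_eq⟩ := h_aim j
  rw [hu_eq t hj, hv_eq t hj, ← mul_div_cancel₀ η two_ne_zero]
  set r := Δ.node j.castSucc
  have hr : r ∈ Icc 0 T := Δ.node_mem_Icc _
  have ht' : t ∈ Icc 0 T := Ico_subset_Icc_self ht
  have hrt : t - r ≤ min δ ρ := by linarith [hj.2, Δ.node_sub_le_diam j]
  have hx_sub := hδ x hx r t hr.1 hj.1 ht'.2 (hrt.trans (min_le_left _ _))
  have hy_sub := hδ y hy r t hr.1 hj.1 ht'.2 (hrt.trans (min_le_left _ _))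
  have h_sub_mem {t} (ht : t ∈ Icc 0 T) : x t - y t ∈ Metric.closedBall 0 (2 * M) :=
    mem_closedBall_zero_iff.2 ((norm_sub_le _ _).trans (by linarith [hM x hx t ht, hM y hy t ht]))
  refine hg.inner_sub_le_of_mem_argMin_argMax hr huj hvj (hu'.2 t ht) (hv.2 t ht)
    (hL t ht' _ (h_ball hx ht') _ (h_ball hy ht') _ (hu'.2 t ht) _ hvj.1) ?_
  have h_double := Metric.closedBall_subset_closedBall (x := (0 : E n)) (show M ≤ 2 * M by linarith)
  refine hρ t ht' r hr ?_ _ (h_double (h_ball hx ht')) _ (h_double (h_ball hx hr)) (by linarith)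
    _ (h_sub_mem ht') _ (h_sub_mem hr) ?_
  · rw [abs_of_nonneg (sub_nonneg.2 hj.1)]
    exact hrt.trans (min_le_right _ _)
  · rw [sub_sub_sub_comm]
    exact (norm_sub_le _ _).trans (by linarith)

lemma IsConflictSystem.exists_norm_sub_sq_le_of_isMutualAiming (hg : IsConflictSystem T P Q g)
    (hα₀ : 0 < α) (hα₁ : α < 1) (hT : 0 < T) {R : ℝ} (hR : 0 ≤ R) :
    ∃ C > 0, ∀ η > 0, ∃ δ > 0, ∀ x₀ ∈ Metric.closedBall (0 : E n) R,
      ∀ y₀ ∈ Metric.closedBall (0 : E n) R, ∀ Δ : TimePartition T, Δ.diam ≤ δ →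
      ∀ u u' v v', IsAdmissible T P u → IsAdmissible T P u' → IsAdmissible T Q v →
      IsAdmissible T Q v' → ∀ x y, IsMotion α T g x₀ u v x → IsMotion α T g y₀ u' v' y →
      IsMutualAiming P Q g Δ x y u v' →
      ∀ t ∈ Icc 0 T, ‖x t - y t‖ ^ 2 ≤ C * ‖x₀ - y₀‖ ^ 2 + η := by
  obtain ⟨L, hL₀, hL⟩ := hg.exists_inner_sub_le_of_isMutualAiming hα₀ hα₁ hR
  let C := 2 * Real.exp ((4 * L) ^ (1 / α) * T)
  let κ := rlKernel (α + 1) T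
  have hC₀ : 0 < C := by positivity
  have hκ₀ : 0 < κ := rlKernel_pos (by positivity) hT
  refine ⟨C, hC₀, fun η hη => ?_⟩
  obtain ⟨δ, hδ₀, hδ⟩ := hL (η / (2 * C * κ)) (by positivity)
  refine ⟨δ, hδ₀, ?_⟩
  intro x₀ hx₀ y₀ hy₀ Δ hΔ u u' v v' hu hu' hv hv' x y hx hy h_aim t ht
  have h_inner := hδ x ⟨x₀, hx₀, u, v, hu, hv, hx⟩ y ⟨y₀, hy₀, u', v', hu', hv', hy⟩ Δ hΔ
    u u' v v' hu' hv h_aim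
  calc ‖x t - y t‖ ^ 2
    _ ≤ 2 * (‖x₀ - y₀‖ ^ 2 + 2 * (η / (2 * C * κ)) * κ) * Real.exp ((4 * L) ^ (1 / α) * T) :=
      IsCauchySolution.norm_sub_sq_le hx hy hα₀ hα₁ hL₀ (by positivity)
        ((ae_segMeasure_mem_Ico T).mono h_inner) ht
    _ = C * (‖x₀ - y₀‖ ^ 2 + 2 * (η / (2 * C * κ)) * κ) := by ring
    _ = C * ‖x₀ - y₀‖ ^ 2 + η := by field_simp

end Control

lemma le_add_sqrt_mul_of_sq_le {a c d ε : ℝ} (hc : 0 ≤ c) (hd : 0 ≤ d) (hε : 0 ≤ ε)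
    (h : a ^ 2 ≤ c * d ^ 2 + ε ^ 2) : a ≤ ε + √c * d := by
  refine le_of_sq_le_sq ?_ (by positivity)
  have h_cross : 0 ≤ 2 * ε * (√c * d) := by positivity
  calc a ^ 2 ≤ √c ^ 2 * d ^ 2 + ε ^ 2 := by rwa [Real.sq_sqrt hc]
    _ ≤ (ε + √c * d) ^ 2 := by linarith

end FractionalControl

theorem mainTheorem1 (n nu nv : ℕ) (α T : ℝ) (hα₀ : 0 < α) (hα₁ : α < 1) (hT : 0 < T)
    (P : Set (FractionalControl.E nu)) (Q : Set (FractionalControl.E nv))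
    (g : ℝ → FractionalControl.E n → FractionalControl.E nu → FractionalControl.E nv →
      FractionalControl.E n)
    (hg : FractionalControl.IsConflictSystem T P Q g) :
    ∀ R₀ : ℝ, 0 < R₀ → ∀ ε : ℝ, 0 < ε →
      ∃ K : ℝ, 0 < K ∧ ∃ δ : ℝ, 0 < δ ∧
        ∀ x₀ ∈ Metric.closedBall (0 : FractionalControl.E n) R₀,
        ∀ y₀ ∈ Metric.closedBall (0 : FractionalControl.E n) R₀,
        ∀ Δ : FractionalControl.TimePartition T, Δ.diam ≤ δ →
        ∀ v : ℝ → FractionalControl.E nv, FractionalControl.IsAdmissible T Q v →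
        ∀ u' : ℝ → FractionalControl.E nu, FractionalControl.IsAdmissible T P u' →
        ∀ u : ℝ → FractionalControl.E nu, FractionalControl.IsAdmissible T P u →
        ∀ v' : ℝ → FractionalControl.E nv, FractionalControl.IsAdmissible T Q v' →
        ∀ x y : ℝ → FractionalControl.E n,
          FractionalControl.IsMotion α T g x₀ u v x →
          FractionalControl.IsMotion α T g y₀ u' v' y →
          FractionalControl.IsMutualAiming P Q g Δ x y u v' →
            MeasureTheory.eLpNorm (fun t => x t - y t) ⊤ (FractionalControl.segMeasure T) ≤
              ENNReal.ofReal (ε + K * ‖x₀ - y₀‖) := by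
  intro R₀ hR₀ ε hε
  obtain ⟨C, hC₀, hC⟩ := hg.exists_norm_sub_sq_le_of_isMutualAiming hα₀ hα₁ hT hR₀.le
  obtain ⟨δ, hδ₀, hδ⟩ := hC (ε ^ 2) (by positivity)
  refine ⟨√C, Real.sqrt_pos.2 hC₀, δ, hδ₀, ?_⟩
  intro x₀ hx₀ y₀ hy₀ Δ hΔ v hv u' hu' u hu v' hv' x y hx hy h_aim
  rw [MeasureTheory.eLpNorm_exponent_top]
  refine MeasureTheory.eLpNormEssSup_le_of_ae_bound ?_
  filter_upwards [FractionalControl.ae_segMeasure_mem_Icc T] with t ht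
  exact FractionalControl.le_add_sqrt_mul_of_sq_le hC₀.le (norm_nonneg _) hε.le
    (hδ x₀ hx₀ y₀ hy₀ Δ hΔ u u' v v' hu hu' hv hv' x y hx hy h_aim t ht)
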